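/- Let $T>0$, $\sigma\in\mathbb R$, $c,\xi,a_0>0$, $a_1,a_2\ge 0$, let $0<\underline Y<\overline Y<\infty$ be integer multiples of $\xi$, put $Q=\{\underline Y,\underline Y+\xi,\dots,\overline Y\}$, and let $\mathfrak r:\mathbb R_+\to\mathbb R_+$ have at most linear growth. Put $\varphi_c(y)=c/y$ and $$\beta^b(y,S)=\varphi_c(y+\xi)-\varphi_c(y)+\xi S+\mathfrak r(y),\qquad \beta^a(y,S)=\varphi_c(y-\xi)-\varphi_c(y)-\xi S+\mathfrak r(y),$$ $$\bar\lambda^b(y,S)=\max\{a_0,a_1+a_2(c/y^2-S)\},\qquad \bar\lambda^a(y,S)=\max\{a_0,a_1+a_2(S-c/y^2)\}.$$ Let $(\Omega,\mathcal F,\hat{\mathbb P})$ be a probability space carrying, on $[0,T]$, a Brownian motion $W$ with continuous paths and two Poisson processes $\hat N^b,\hat N^a$ of intensity $a_0$ with piecewise constant càdlàg paths in $\mathbb N$, the three processes being independent, and let $\mathbb F$ be the $\hat{\mathbb P}$-augmented filtration that they generate (for instance, the canonical space). For $(t,y,S)\in[0,T]\times Q\times\mathbb R$ and $u\in[t,T]$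 let $S^{t,S}_u=S+\sigma(W_u-W_t)$, and let $Y^{t,y}$ be the solution on $[t,T]$ of $$dY_u=\xi\,\mathbf 1_{\{Y_{u-}+\xi\le\overline Y\}}\,d\hat N^b_u-\xi\,\mathbf 1_{\{Y_{u-}-\xi\ge\underline Y\}}\,d\hat N^a_u,\qquad Y_t=y,$$ with $Y^{t,y}_{t-}:=y$. Put $\lambda^i_u=\bar\lambda^i(Y^{t,y}_{u-},S^{t,S}_u)$ for $i\in\{a,b\}$, and let $\mathbb P^{t,y,S}$ be the measure with density $$\frac{d\mathbb P^{t,y,S}}{d\hat{\mathbb P}}=\exp\Big\{\sum_{i=a,b}\Big(\int_t^T\log\frac{\lambda^i_u}{a_0}\,d\hat N^i_u-\int_t^T(\lambda^i_u-a_0)\,du\Big)\Big\}.$$ Let $\mathcal T_{t,T}$ be the set of $\mathbb F$-stopping times with values in $[t,T]$ and define the value function $$v(t,y,S)=\sup_{\tau\in\mathcal T_{t,T}}\mathbb E^{\mathbb P^{t,y,S}}\Big[\int_t^\tau\Big\{\beta^b(Y^{t,y}_{u-},S^{t,S}_u)\lambda^b_u\mathbf 1_{\{Y^{t,y}_{u-}+\xi\le\overline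 Y\}}+\beta^a(Y^{t,y}_{u-},S^{t,S}_u)\lambda^a_u\mathbf 1_{\{Y^{t,y}_{u-}-\xi\ge\underline Y\}}\Big\}du\Big].$$ Then $v$ is well defined: for every $(t,y,S)\in[0,T]\times Q\times\mathbb R$, $\mathbb P^{t,y,S}$ is a probability measure; for every $\tau\in\mathcal T_{t,T}$ the time integral exists almost surely and is $\mathbb P^{t,y,S}$-integrable; and the supremum is over a non-empty set of real numbers that is bounded above. Moreover $v$ belongs to the class $\Xi$ of functions on $[0,T]\times Q\times\mathbb R$ that are non-negative, bounded in the second variable and of at most quadratic growth in the third one: there is a constant $C_0$ such that $$0\le v(t,y,S)\le C_0(1+S^2)\qquad\text{for all }(t,y,S)\in[0,T]\times Q\times\mathbb R.$$ -/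

import Mathlib

open MeasureTheory ProbabilityTheory Filter Topology Set

noncomputable section

namespace AMM

/-- The parameters of the pool `x * y = c`, of the oracle price, of the order flow, and the fee
function (of which only the values on `[0, ∞)` matter). -/
structure Model where
  /-- trading horizon -/
  T : ℝ
  T_pos : 0 < T
  /-- volatility of the oracle price -/
  σ : ℝ
  /-- depth of the pool -/
  c : ℝ
  c_pos : 0 < c
  /-- trade size -/
  ξ : ℝ
  ξ_pos : 0 < ξ
  /-- lower bound of the reserve -/
  Ylo : ℝ
  /-- upper bound of the reserve -/
  Yhi : ℝ
  Ylo_pos : 0 < Ylo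
  Ylo_lt_Yhi : Ylo < Yhi
  Ylo_multiple : ∃ k : ℕ, Ylo = k * ξ
  Yhi_multiple : ∃ k : ℕ, Yhi = k * ξ
  a0 : ℝ
  a1 : ℝ
  a2 : ℝ
  a0_pos : 0 < a0
  a1_nonneg : 0 ≤ a1
  a2_nonneg : 0 ≤ a2
  /-- fee earned on a trade, as a function of the reserve -/
  fee : ℝ → ℝ
  fee_nonneg : ∀ y, 0 ≤ y → 0 ≤ fee y
  fee_growth : ∃ K : ℝ, ∀ y, 0 ≤ y → fee y ≤ K * (1 + y)

namespace Model

variable (M : Model)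

/-- The time interval `[0, T]`. -/
abbrev Time : Type := Icc (0 : ℝ) M.T

/-- The reserve grid `{Ylo, Ylo + ξ, …, Yhi}`. -/
def Q : Set ℝ := {y | ∃ k : ℕ, y = M.Ylo + k * M.ξ ∧ y ≤ M.Yhi}

/-- The Lebesgue measure on `[0, T]`. -/
def lebesgue : Measure M.Time := Measure.comap Subtype.val volume

/-- The level function of the pool. -/
def φ (y : ℝ) : ℝ := M.c / y

def betaB (y S : ℝ) : ℝ := M.φ (y + M.ξ) - M.φ y + M.ξ * S + M.fee y

def betaA (y S : ℝ) : ℝ := M.φ (y - M.ξ) - M.φ y - M.ξ * S + M.fee y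

def lamB (y S : ℝ) : ℝ := max M.a0 (M.a1 + M.a2 * (M.c / y ^ 2 - S))

def lamA (y S : ℝ) : ℝ := max M.a0 (M.a1 + M.a2 * (S - M.c / y ^ 2))

open Classical in
/-- The running reward rate, as a function of the state. -/
def rewardRate (y S : ℝ) : ℝ :=
  betaB M y S * lamB M y S * (if y + M.ξ ≤ M.Yhi then 1 else 0)
    + betaA M y S * lamA M y S * (if M.Ylo ≤ y - M.ξ then 1 else 0)

/-- The class of non-negative functions on `[0, T] × Q × ℝ` that are bounded in the second variable
and of at most quadratic growth in the third one. -/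
def Xi : Set (M.Time → M.Q → ℝ → ℝ) :=
  {u | ∃ C₀ : ℝ, ∀ (t : M.Time) (y : M.Q) (S : ℝ), 0 ≤ u t y S ∧ u t y S ≤ C₀ * (1 + S ^ 2)}

/-! ### Counting paths and the reserve that they drive -/

/-- Càdlàg paths with values in the discrete space `ℕ`, that is (`[0, T]` being compact), piecewise
constant càdlàg paths with finitely many jumps. -/
def IsCadlagPath (n : M.Time → ℕ) : Prop :=
  ∀ s, ContinuousWithinAt n (Ici s) s ∧ ∃ l, Tendsto n (𝓝[<] s) (𝓝 l)

/-- The jump `n s - n (s-)`; it is `0` at time `0`. -/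
def jump (n : M.Time → ℕ) (s : M.Time) : ℝ := (n s : ℝ) - (Function.leftLim n s : ℕ)

lemma finite_jumps {n : M.Time → ℕ} (hn : M.IsCadlagPath n) : {s | M.jump n s ≠ 0}.Finite := by
  have hloc : ∀ s : M.Time, ∀ᶠ r in 𝓝[≠] s, M.jump n r = 0 := by
    intro s
    have key : ∀ (I : Set M.Time) (l : ℕ), IsOpen I → (∀ r ∈ I, n r = l) →
        ∀ r ∈ I, M.jump n r = 0 := by
      intro I l hI hc r hr
      have : ContinuousAt n r := by
        refine (continuousAt_const (y := l)).congr ?_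
        filter_upwards [hI.mem_nhds hr] with x hx using (hc x hx).symm
      rw [jump, (this.continuousWithinAt (s := Iic r)).leftLim_eq, sub_self]
    rw [← Iio_union_Ioi, nhdsWithin_union, eventually_sup]
    obtain ⟨hr, l, hl⟩ := hn s
    constructor
    · have h1 : ∀ᶠ r in 𝓝[<] s, n r = l := by
        exact hl (mem_nhds_discrete.2 (mem_singleton l))
      obtain ⟨U, hU, hsU, hUn⟩ := mem_nhdsWithin.1 h1
      have := key (U ∩ Iio s) l (hU.inter isOpen_Iio) (fun r hr => hUn hr)
      exact mem_nhdsWithin.2 ⟨U, hU, hsU, this⟩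
    · have h1 : ∀ᶠ r in 𝓝[>] s, n r = n s := by
        exact (hr.mono Ioi_subset_Ici_self) (mem_nhds_discrete.2 (mem_singleton (n s)))
      obtain ⟨U, hU, hsU, hUn⟩ := mem_nhdsWithin.1 h1
      have := key (U ∩ Ioi s) (n s) (hU.inter isOpen_Ioi) (fun r hr => hUn hr)
      exact mem_nhdsWithin.2 ⟨U, hU, hsU, this⟩
  by_contra hinf
  obtain ⟨x, hx⟩ := Set.Infinite.exists_accPt_principal hinf
  rw [accPt_iff_frequently_nhdsNE] at hx
  exact hx ((hloc x).mono fun r hr h => h hr)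

open Classical in
/-- The finite set of the jump times in `A` of a pair of càdlàg counting paths (the set in the
condition is always finite for such paths, see `finite_jumps`). -/
def jumpTimes (nb na : M.Time → ℕ) (A : Set M.Time) : Finset M.Time :=
  if h : {s | s ∈ A ∧ (M.jump nb s ≠ 0 ∨ M.jump na s ≠ 0)}.Finite then h.toFinset else ∅

lemma mem_jumpTimes {nb na : M.Time → ℕ} (hb : M.IsCadlagPath nb) (ha : M.IsCadlagPath na)
    (A : Set M.Time) (s : M.Time) :
    s ∈ M.jumpTimes nb na A ↔ s ∈ A ∧ (M.jump nb s ≠ 0 ∨ M.jump na s ≠ 0) := by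
  have h : {s | s ∈ A ∧ (M.jump nb s ≠ 0 ∨ M.jump na s ≠ 0)}.Finite :=
    ((M.finite_jumps hb).union (M.finite_jumps ha)).subset fun s hs => hs.2
  rw [jumpTimes, dif_pos h, Set.Finite.mem_toFinset, mem_ofPred_eq]

open Classical in
/-- The increment of the reserve at time `s` when its value just before `s` is `z`: a sell order
moves it up by `ξ` and a buy order moves it down by `ξ`, unless it would leave `[Ylo, Yhi]`. -/
def reserveIncrement (nb na : M.Time → ℕ) (z : ℝ) (s : M.Time) : ℝ :=
  M.ξ * ((if z + M.ξ ≤ M.Yhi then 1 else 0) * M.jump nb s)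
    - M.ξ * ((if M.Ylo ≤ z - M.ξ then 1 else 0) * M.jump na s)

/-- The value reached from `y` by performing the jumps in the finite set `J` in their order. -/
def runJumps (nb na : M.Time → ℕ) (y : ℝ) (J : Finset M.Time) : ℝ :=
  (J.sort (· ≤ ·)).foldl (fun z s => z + M.reserveIncrement nb na z s) y

/-- The reserve at time `u ≥ t`, started from `y` at time `t`. It is the solution of
`dY = ξ 1_{Y₋ + ξ ≤ Yhi} dnb - ξ 1_{Y₋ - ξ ≥ Ylo} dna`, see `reserve_eq` and
`tendsto_reserve_left`. -/
def reserve (nb na : M.Time → ℕ) (t : M.Time) (y : ℝ) (u : M.Time) : ℝ :=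
  M.runJumps nb na y (M.jumpTimes nb na (Ioc t u))

/-- The reserve just before time `u`, started from `y` at time `t`. -/
def reserveLeft (nb na : M.Time → ℕ) (t : M.Time) (y : ℝ) (u : M.Time) : ℝ :=
  M.runJumps nb na y (M.jumpTimes nb na (Ioo t u))

lemma runJumps_insert_max (nb na : M.Time → ℕ) (y : ℝ) (J : Finset M.Time) (s : M.Time)
    (hs : ∀ r ∈ J, r < s) :
    M.runJumps nb na y (insert s J) =
      M.runJumps nb na y J + M.reserveIncrement nb na (M.runJumps nb na y J) s := by
  have hsort : (insert s J).sort (· ≤ ·) = J.sort (· ≤ ·) ++ [s] := by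
    refine List.Perm.eq_of_pairwise' (r := (· ≤ ·)) (Finset.pairwise_sort _ _) ?_ ?_
    · rw [List.pairwise_append]
      refine ⟨Finset.pairwise_sort _ _, List.pairwise_singleton _ _, ?_⟩
      intro a ha b hb
      rw [List.mem_singleton] at hb
      subst hb
      exact (hs a ((Finset.mem_sort _).1 ha)).le
    · have hnot : s ∉ J := fun h => lt_irrefl _ (hs s h)
      rw [List.perm_ext_iff_of_nodup (Finset.sort_nodup _ _)]
      · intro a
        simp [or_comm]
      · rw [List.nodup_append]
        refine ⟨Finset.sort_nodup _ _, List.nodup_singleton _, ?_⟩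
        intro a ha b hb hab
        rw [List.mem_singleton] at hb
        subst hb hab
        exact hnot ((Finset.mem_sort _).1 ha)
  simp [runJumps, hsort, List.foldl_append]

/-- `reserve` solves the integral equation of the reserve. -/
lemma reserve_eq {nb na : M.Time → ℕ} (hb : M.IsCadlagPath nb) (ha : M.IsCadlagPath na)
    (t : M.Time) (y : ℝ) (u : M.Time) :
    M.reserve nb na t y u = y + ∑ s ∈ M.jumpTimes nb na (Ioc t u),
      M.reserveIncrement nb na (M.reserveLeft nb na t y s) s := by
  classical
  have main : ∀ J K : Finset M.Time, J = K.filter (· ∈ J) →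
      (∀ s ∈ J, ∀ r ∈ K, r < s → r ∈ J) →
      M.runJumps nb na y J = y + ∑ s ∈ J,
        M.reserveIncrement nb na (M.runJumps nb na y (K.filter (· < s))) s := by
    intro J K
    induction J using Finset.induction_on_max with
    | empty => intro _ _; simp [runJumps]
    | insert s J hs ih =>
      intro hJK hdown
      have hnot : s ∉ J := fun h => lt_irrefl _ (hs s h)
      have hsub : ∀ r ∈ insert s J, r ∈ K := fun r hr => by
        rw [hJK] at hr; exact (Finset.mem_filter.1 hr).1
      have hfil : K.filter (· < s) = J := by
        ext r
        simp only [Finset.mem_filter]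
        constructor
        · rintro ⟨hr, hrs⟩
          have := hdown s (Finset.mem_insert_self _ _) r hr hrs
          exact (Finset.mem_insert.1 this).resolve_left hrs.ne
        · intro hr
          exact ⟨hsub r (Finset.mem_insert_of_mem hr), hs r hr⟩
      rw [M.runJumps_insert_max nb na y J s hs, Finset.sum_insert hnot, hfil, ih]
      · ring
      · ext r
        simp only [Finset.mem_filter]
        exact ⟨fun hr => ⟨hsub r (Finset.mem_insert_of_mem hr), hr⟩, fun h => h.2⟩
      · intro r hr q hq hqr
        have := hdown r (Finset.mem_insert_of_mem hr) q hq hqr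
        rcases Finset.mem_insert.1 this with h | h
        · subst h
          exact absurd (hs r hr) (not_lt.2 hqr.le)
        · exact h
  rw [reserve, main _ (M.jumpTimes nb na (Ioc t u)) (by simp) (fun _ _ r hr _ => hr)]
  congr 1
  refine Finset.sum_congr rfl fun s hs => ?_
  rw [reserveLeft]
  congr 2
  ext r
  rw [Finset.mem_filter, M.mem_jumpTimes hb ha, M.mem_jumpTimes hb ha]
  have hsu := ((M.mem_jumpTimes hb ha _ _).1 hs).1.2
  constructor
  · rintro ⟨⟨h1, h2⟩, h3⟩
    exact ⟨⟨h1.1, h3⟩, h2⟩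
  · rintro ⟨h1, h2⟩
    exact ⟨⟨⟨h1.1, h1.2.le.trans hsu⟩, h2⟩, h1.2⟩

/-- `reserveLeft` is the left limit of `reserve`. -/
lemma tendsto_reserve_left {nb na : M.Time → ℕ} (hb : M.IsCadlagPath nb)
    (ha : M.IsCadlagPath na) (t : M.Time) (y : ℝ) (u : M.Time) :
    Tendsto (M.reserve nb na t y) (𝓝[<] u) (𝓝 (M.reserveLeft nb na t y u)) := by
  refine tendsto_const_nhds.congr' ?_
  have h : ∀ᶠ v in 𝓝[<] u, ∀ r ∈ M.jumpTimes nb na (Ioo t u), r ≤ v := by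
    rw [Finset.eventually_all]
    intro r hr
    have hru := ((M.mem_jumpTimes hb ha _ _).1 hr).1.2
    filter_upwards [mem_nhdsWithin_of_mem_nhds (Ioi_mem_nhds hru)] with v hv using le_of_lt hv
  filter_upwards [h, self_mem_nhdsWithin] with v hv hvu
  rw [reserveLeft, reserve]
  congr 1
  ext r
  rw [M.mem_jumpTimes hb ha, M.mem_jumpTimes hb ha]
  constructor
  · intro hr
    exact ⟨⟨hr.1.1, hv r ((M.mem_jumpTimes hb ha _ _).2 hr)⟩, hr.2⟩
  · intro hr
    exact ⟨⟨hr.1.1, lt_of_le_of_lt hr.1.2 hvu⟩, hr.2⟩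

/-! ### The driving noise -/

/-- `W` is a Brownian motion on `[0, T]`. -/
structure IsBrownian {Ω : Type*} [MeasurableSpace Ω] (P : Measure Ω) (W : M.Time → Ω → ℝ) :
    Prop where
  measurable : ∀ t, Measurable (W t)
  continuous : ∀ ω, Continuous fun t => W t ω
  start : ∀ t : M.Time, (t : ℝ) = 0 → ∀ᵐ ω ∂P, W t ω = 0
  indep : HasIndepIncrements W P
  law : ∀ s t : M.Time, s ≤ t →
    HasLaw (fun ω => W t ω - W s ω) (gaussianReal 0 ((t : ℝ) - s).toNNReal) P

/-- `N` is a Poisson process on `[0, T]` with intensity `a0`. -/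
structure IsPoisson {Ω : Type*} [MeasurableSpace Ω] (P : Measure Ω) (N : M.Time → Ω → ℕ) :
    Prop where
  measurable : ∀ t, Measurable (N t)
  cadlag : ∀ ω, M.IsCadlagPath fun t => N t ω
  start : ∀ t : M.Time, (t : ℝ) = 0 → ∀ᵐ ω ∂P, N t ω = 0
  indep : HasIndepIncrements (fun t ω => (N t ω : ℤ)) P
  law : ∀ s t : M.Time, s ≤ t →
    HasLaw (fun ω => (N t ω : ℤ) - N s ω)
      ((poissonMeasure (M.a0 * ((t : ℝ) - s)).toNNReal).map (Nat.cast : ℕ → ℤ)) P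

/-- A Brownian motion `W` and two Poisson processes `Nb` (sell orders) and `Na` (buy orders) with
intensity `a0`, independent under the reference measure `P`. -/
structure Driver {Ω : Type*} [MeasurableSpace Ω] (P : Measure Ω) where
  W : M.Time → Ω → ℝ
  Nb : M.Time → Ω → ℕ
  Na : M.Time → Ω → ℕ
  brownian : M.IsBrownian P W
  poissonB : M.IsPoisson P Nb
  poissonA : M.IsPoisson P Na
  indep_W : IndepFun (fun ω t => W t ω) (fun ω => ((fun t => Nb t ω), fun t => Na t ω)) P
  indep_N : IndepFun (fun ω t => Nb t ω) (fun ω t => Na t ω) P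

end Model

namespace Model.Driver

variable {M : Model} {Ω : Type*} [mΩ : MeasurableSpace Ω] {P : Measure Ω} (D : M.Driver P)

/-- The σ-algebra generated by `W`, `Nb`, `Na` up to time `s`. -/
@[reducible] def history (s : M.Time) : MeasurableSpace Ω :=
  ⨆ r ≤ s, (MeasurableSpace.comap (D.W r) inferInstance ⊔
    MeasurableSpace.comap (D.Nb r) inferInstance ⊔ MeasurableSpace.comap (D.Na r) inferInstance)

lemma history_le (s : M.Time) : D.history s ≤ mΩ :=
  iSup₂_le fun r _ => sup_le (sup_le (D.brownian.measurable r).comap_le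
    (D.poissonB.measurable r).comap_le) (D.poissonA.measurable r).comap_le

/-- The canonical filtration of `(W, Nb, Na)`, augmented by all `P`-null sets (inside the
`P`-completion of the ambient σ-algebra). -/
def filtration : Filtration M.Time (eventuallyMeasurableSpace mΩ (ae P)) where
  seq s := eventuallyMeasurableSpace (D.history s) (ae P)
  mono' := by
    rintro s s' hs A ⟨B, hB, hAB⟩
    have hmono : D.history s ≤ D.history s' := biSup_mono fun _ h => h.trans hs
    exact ⟨B, hmono _ hB, hAB⟩
  le' := by
    rintro s A ⟨B, hB, hAB⟩
    exact ⟨B, D.history_le s _ hB, hAB⟩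

/-- The stopping times with values in `[t, T]`. -/
def StoppingTimes (t : M.Time) : Type _ :=
  {τ : Ω → M.Time // IsStoppingTime D.filtration (fun ω => (τ ω : WithTop M.Time)) ∧ ∀ ω, t ≤ τ ω}

/-- The oracle price at time `u`, started from `S` at time `t`. -/
def price (t : M.Time) (S : ℝ) (u : M.Time) (ω : Ω) : ℝ := S + M.σ * (D.W u ω - D.W t ω)

/-- The reserve just before time `u`, started from `y` at time `t`. -/
def reserveLeft (t : M.Time) (y : ℝ) (u : M.Time) (ω : Ω) : ℝ :=
  M.reserveLeft (fun s => D.Nb s ω) (fun s => D.Na s ω) t y u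

/-- The intensity of the sell orders, for the state started from `(y, S)` at time `t`. -/
def intensityB (t : M.Time) (y S : ℝ) (u : M.Time) (ω : Ω) : ℝ :=
  M.lamB (D.reserveLeft t y u ω) (D.price t S u ω)

/-- The intensity of the buy orders, for the state started from `(y, S)` at time `t`. -/
def intensityA (t : M.Time) (y S : ℝ) (u : M.Time) (ω : Ω) : ℝ :=
  M.lamA (D.reserveLeft t y u ω) (D.price t S u ω)

/-- The jump times of `Nb` and `Na` in `(t, T]`. -/
def times (t : M.Time) (ω : Ω) : Finset M.Time :=
  M.jumpTimes (fun s => D.Nb s ω) (fun s => D.Na s ω) (Ioi t)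

/-- The Doléans-Dade exponential over `(t, T]`,
`exp (∑ᵢ ∫ log (λⁱ / a0) dNⁱ - ∫ (λⁱ - a0) du)`. -/
def density (t : M.Time) (y S : ℝ) (ω : Ω) : ℝ :=
  Real.exp
    (((∑ u ∈ D.times t ω,
          Real.log (D.intensityB t y S u ω / M.a0) * M.jump (fun s => D.Nb s ω) u)
        - ∫ u in Ioi t, (D.intensityB t y S u ω - M.a0) ∂M.lebesgue)
      + ((∑ u ∈ D.times t ω,
          Real.log (D.intensityA t y S u ω / M.a0) * M.jump (fun s => D.Na s ω) u)
        - ∫ u in Ioi t, (D.intensityA t y S u ω - M.a0) ∂M.lebesgue))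

/-- The measure under which, for the state started from `(y, S)` at time `t`, the orders arrive
with the intensities `intensityB` and `intensityA`. -/
def stateMeasure (t : M.Time) (y S : ℝ) : Measure Ω :=
  P.withDensity fun ω => ENNReal.ofReal (D.density t y S ω)

/-- The running reward rate at time `u`. -/
def rate (t : M.Time) (y S : ℝ) (u : M.Time) (ω : Ω) : ℝ :=
  M.rewardRate (D.reserveLeft t y u ω) (D.price t S u ω)

/-- The reward collected between `t` and `τ`. -/
def reward (t : M.Time) (y S : ℝ) (τ : Ω → M.Time) (ω : Ω) : ℝ :=
  ∫ u in Ioc t (τ ω), D.rate t y S u ω ∂M.lebesgue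

/-- The expected reward of the stopping time `τ`. -/
def expectedReward (t : M.Time) (y S : ℝ) (τ : D.StoppingTimes t) : ℝ :=
  ∫ ω, D.reward t y S τ.1 ω ∂(D.stateMeasure t y S)

/-- The value function of the optimal stopping problem. -/
def value (t : M.Time) (y : M.Q) (S : ℝ) : ℝ := ⨆ τ : D.StoppingTimes t, D.expectedReward t y S τ

end Model.Driver

end AMM

end

/-! The intensities are affine in a Brownian price where the floor `a0` is not active, hence in
general unbounded, so it is not automatic that the exponential density has mass one. What saves it
is the independence of `W` and the order flow: given the whole path of `W` the intensities are
bounded, because the reserve lives in a bounded interval, and the density then has conditional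
expectation one. This proves more than mass one: the path of `W` keeps its law under the change of
measure (`map_pathW_stateMeasure`), so the moments of the price remain Gaussian.

The argument avoids stochastic calculus. On a uniform grid of `[t, T]` the intensities are frozen at
the left end of each cell and the reserve is replaced by a chain driven by the increments of the
orders. The density becomes a product of one-cell likelihood ratios, each of integral one given the
path of `W` and the earlier increments (`lintegral_ratio`), so over any event about `W` it
integrates to the probability of that event (`setLIntegral_discreteDensity`). As the mesh shrinks,
the finitely many jumps, almost surely of size one, are separated by the grid; the chain then is the
reserve, and the discretized density converges to the true one (`tendsto_discreteDensity`). Where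
`|W| ≤ R` there is an integrable majorant, exponential in the number of orders, so the identity
survives the limit; then `R` tends to infinity.

For the growth bound, the reward rate is at most quadratic in the price, uniformly in the reserve
(`exists_abs_rewardRate_le`). Tonelli and the second moment of the price
(`lintegral_price_sq_stateMeasure`) bound the integral of its absolute value over all of `(t, T]`,
hence every expected reward uniformly in the stopping time. Stopping at once earns zero, which gives
non-negativity. -/

noncomputable section

namespace AMM.Model

variable (M : Model)

/-! ### Uniform grids on `[t, T]` -/

/-- The mesh of the uniform grid of `[t, T]` with `n + 1` cells. -/
def mesh (t : M.Time) (n : ℕ) : ℝ := (M.T - t) / (n + 1)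

/-- The points of the uniform grid of `[t, T]` with `n + 1` cells. -/
def grid (t : M.Time) (n k : ℕ) : M.Time :=
  projIcc 0 M.T M.T_pos.le (t + k * M.mesh t n)

/-- The index of the cell `(grid k, grid (k + 1)]` that contains `u`. -/
def idx (t : M.Time) (n : ℕ) (u : M.Time) : ℕ := ⌈((u : ℝ) - t) / M.mesh t n⌉₊ - 1

variable {M}

lemma mesh_nonneg (t : M.Time) (n : ℕ) : 0 ≤ M.mesh t n :=
  div_nonneg (sub_nonneg.2 t.2.2) (by positivity)

lemma mesh_pos {t u : M.Time} (h : t < u) (n : ℕ) : 0 < M.mesh t n :=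
  div_pos (sub_pos.2 (lt_of_lt_of_le (show (t : ℝ) < u from h) u.2.2)) (by positivity)

lemma tendsto_mesh (t : M.Time) : Tendsto (M.mesh t) atTop (𝓝 0) :=
  tendsto_const_nhds.div_atTop
    (tendsto_atTop_add_const_right _ _ tendsto_natCast_atTop_atTop)

lemma coe_grid (t : M.Time) {n k : ℕ} (hk : k ≤ n + 1) :
    (M.grid t n k : ℝ) = t + k * M.mesh t n := by
  have h0 : 0 ≤ (t : ℝ) + k * M.mesh t n :=
    add_nonneg t.2.1 (mul_nonneg (by positivity) (mesh_nonneg t n))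
  have h1 : (t : ℝ) + k * M.mesh t n ≤ M.T := by
    have : (k : ℝ) * M.mesh t n ≤ (n + 1) * M.mesh t n :=
      mul_le_mul_of_nonneg_right (by exact_mod_cast hk) (mesh_nonneg t n)
    have h2 : ((n : ℝ) + 1) * M.mesh t n = M.T - t := by rw [mesh]; field_simp
    linarith
  rw [grid, projIcc_of_mem _ ⟨h0, h1⟩]

lemma grid_zero (t : M.Time) (n : ℕ) : M.grid t n 0 = t :=
  Subtype.ext (by rw [coe_grid t (Nat.zero_le _)]; simp)

lemma grid_mono (t : M.Time) (n : ℕ) : Monotone (M.grid t n) := fun j k h =>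
  monotone_projIcc _ (by
    have : (j : ℝ) ≤ k := by exact_mod_cast h
    have := mul_le_mul_of_nonneg_right this (mesh_nonneg t n)
    linarith)

lemma le_grid (t : M.Time) (n k : ℕ) : t ≤ M.grid t n k := by
  conv_lhs => rw [← grid_zero t n]
  exact grid_mono t n (Nat.zero_le _)

lemma coe_grid_succ_sub (t : M.Time) {n k : ℕ} (hk : k < n + 1) :
    (M.grid t n (k + 1) : ℝ) - M.grid t n k = M.mesh t n := by
  rw [coe_grid t hk, coe_grid t hk.le]; push_cast; ring

/-- Cells are open on the left, so the left end lies strictly before `u`; evaluating there keeps the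
discretized intensities predictable. -/
lemma idx_spec {t u : M.Time} (h : t < u) (n : ℕ) :
    M.idx t n u < n + 1 ∧ u ∈ Ioc (M.grid t n (M.idx t n u)) (M.grid t n (M.idx t n u + 1)) := by
  have hm := mesh_pos h n
  have htu : (t : ℝ) < u := h
  set x := ((u : ℝ) - t) / M.mesh t n with hx
  have hxpos : 0 < x := div_pos (sub_pos.2 htu) hm
  have hxu : (u : ℝ) = t + x * M.mesh t n := by rw [hx]; field_simp; ring
  -- The subtraction in `idx` is truncated; this bound makes it exact and is where `t < u` matters.
  have hc : 1 ≤ ⌈x⌉₊ := Nat.one_le_ceil_iff.2 hxpos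
  have hidx : M.idx t n u + 1 = ⌈x⌉₊ := by rw [idx, ← hx]; omega
  have hle : ⌈x⌉₊ ≤ n + 1 := by
    refine Nat.ceil_le.2 ?_
    rw [hx, div_le_iff₀ hm]
    have : ((n + 1 : ℕ) : ℝ) * M.mesh t n = M.T - t := by rw [mesh]; push_cast; field_simp
    rw [this]
    linarith [u.2.2]
  have hlt : M.idx t n u < n + 1 := by omega
  refine ⟨hlt, ?_, ?_⟩
  · change (M.grid t n (M.idx t n u) : ℝ) < u
    rw [coe_grid t hlt.le, hxu]
    have h1 : (⌈x⌉₊ : ℝ) < x + 1 := Nat.ceil_lt_add_one hxpos.le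
    rw [← hidx] at h1
    push_cast at h1
    have := mul_lt_mul_of_pos_right (show (M.idx t n u : ℝ) < x by linarith) hm
    linarith
  · change (u : ℝ) ≤ M.grid t n (M.idx t n u + 1)
    rw [coe_grid t hlt, hxu, show (M.idx t n u).succ = ⌈x⌉₊ from hidx]
    have := mul_le_mul_of_nonneg_right (Nat.le_ceil x) hm.le
    linarith

lemma idx_eq {t u : M.Time} {n k : ℕ} (hu : u ∈ Ioc (M.grid t n k) (M.grid t n (k + 1))) :
    M.idx t n u = k := by
  have h : t < u := lt_of_le_of_lt (le_grid t n k) hu.1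
  obtain ⟨-, h1, h2⟩ := idx_spec h n
  rcases lt_trichotomy (M.idx t n u) k with hk | hk | hk
  · exact absurd (h2.trans (grid_mono t n hk)) (not_le.2 hu.1)
  · exact hk
  · exact absurd (hu.2.trans (grid_mono t n hk)) (not_le.2 h1)

lemma dist_grid_idx_le {t u : M.Time} (h : t < u) (n : ℕ) :
    (u : ℝ) - M.grid t n (M.idx t n u) ≤ M.mesh t n := by
  obtain ⟨h0, -, h2⟩ := idx_spec h n
  rw [← coe_grid_succ_sub t h0]
  have : (u : ℝ) ≤ M.grid t n (M.idx t n u + 1) := h2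
  linarith

lemma tendsto_grid_idx {t u : M.Time} (h : t < u) :
    Tendsto (fun n => M.grid t n (M.idx t n u)) atTop (𝓝 u) := by
  rw [tendsto_subtype_rng]
  have h1 : Tendsto (fun n => (u : ℝ) - M.mesh t n) atTop (𝓝 (u : ℝ)) := by
    simpa using (tendsto_mesh t).const_sub (u : ℝ)
  refine tendsto_of_tendsto_of_tendsto_of_le_of_le h1 tendsto_const_nhds ?_ ?_
  · intro n
    have := dist_grid_idx_le h n
    simp only
    linarith
  · intro n
    exact (idx_spec h n).2.1.le

/-- Two points of one cell are less than a mesh apart, while a finite set has a positive smallest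
gap. -/
lemma eventually_injOn_idx (t : M.Time) (J : Finset M.Time) (hJ : ∀ s ∈ J, t < s) :
    ∀ᶠ n in atTop, Set.InjOn (M.idx t n) (J : Set M.Time) := by
  have key : ∀ r ∈ J, ∀ s ∈ J, ∀ᶠ n in atTop, r < s → M.idx t n r ≠ M.idx t n s := by
    intro r hr s hs
    by_cases hrs : r < s
    · have hpos : (0 : ℝ) < s - r := sub_pos.2 hrs
      filter_upwards [(tendsto_mesh t).eventually (gt_mem_nhds hpos)] with n hn _ h
      have h1 := (idx_spec (hJ r hr) n).2.1
      have h2 := dist_grid_idx_le (hJ s hs) n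
      rw [h] at h1
      have h3 : (M.grid t n (M.idx t n s) : ℝ) < r := h1
      linarith
    · exact Eventually.of_forall fun n h => absurd h hrs
  have := (Finset.eventually_all J).2 fun r hr =>
    (Finset.eventually_all J).2 fun s hs => key r hr s hs
  filter_upwards [this] with n hn r hr s hs h
  rcases lt_trichotomy r s with h' | h' | h'
  · exact absurd h (hn r hr s hs h')
  · exact h'
  · exact absurd h.symm (hn s hs r hr h')

/-! ### Increments of càdlàg counting paths -/

/-- Without jumps the path is continuous on a connected interval with values in a discrete space. -/
lemma IsCadlagPath.eq_of_jump_eq_zero {n : M.Time → ℕ} (hn : M.IsCadlagPath n) {u v : M.Time}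
    (huv : u ≤ v) (h : ∀ s ∈ Ioc u v, M.jump n s = 0) : n u = n v := by
  have hpre : IsPreconnected (Icc u v) := by
    rw [← Topology.IsInducing.subtypeVal.isPreconnected_image]
    have : Subtype.val '' Icc u v = Icc (u : ℝ) v := by
      ext x
      constructor
      · rintro ⟨z, hz, rfl⟩
        exact hz
      · intro hx
        exact ⟨⟨x, u.2.1.trans hx.1, hx.2.trans v.2.2⟩, hx, rfl⟩
    rw [this]
    exact isPreconnected_Icc
  have hcont : ContinuousOn n (Icc u v) := by
    intro s hs
    rcases eq_or_lt_of_le hs.1 with rfl | hlt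
    · exact (hn u).1.mono Icc_subset_Ici_self
    · have hj := h s ⟨hlt, hs.2⟩
      have hl := tendsto_leftLim_of_tendsto (hn s).2
      have he : Function.leftLim n s = n s := by
        rw [jump, sub_eq_zero] at hj
        exact_mod_cast hj.symm
      rw [he] at hl
      have : ContinuousAt n s := by
        rw [ContinuousAt, ← nhdsLT_sup_nhdsGE]
        exact hl.sup (hn s).1
      exact this.continuousWithinAt
  exact hpre.constant hcont (left_mem_Icc.2 huv) (right_mem_Icc.2 huv)

lemma IsCadlagPath.sub_eq_jump {n : M.Time → ℕ} (hn : M.IsCadlagPath n) {u s v : M.Time}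
    (hs : s ∈ Ioc u v) (h : ∀ r ∈ Ioc u v, r ≠ s → M.jump n r = 0) :
    (n v : ℝ) - n u = M.jump n s := by
  have h1 : n s = n v := hn.eq_of_jump_eq_zero hs.2 fun r hr =>
    h r ⟨hs.1.trans hr.1, hr.2⟩ hr.1.ne'
  have h2 : ∀ᶠ r in 𝓝[<] s, n r = n u := by
    filter_upwards [Ioo_mem_nhdsLT hs.1] with r hr
    exact (hn.eq_of_jump_eq_zero hr.1.le fun q hq =>
      h q ⟨hq.1, (hq.2.trans hr.2.le).trans hs.2⟩ (hq.2.trans_lt hr.2).ne).symm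
  have hne : (𝓝[<] s).NeBot := nhdsLT_neBot_of_exists_lt ⟨u, hs.1⟩
  have h3 : Function.leftLim n s = n u :=
    leftLim_eq_of_tendsto (tendsto_const_nhds.congr' (h2.mono fun r hr => hr.symm))
  rw [jump, h3, h1]

end AMM.Model
end

noncomputable section

namespace AMM.Model

variable (M : Model)

/-! ### The reserve as a chain driven by the increments over a grid -/

/-- The reserve of index `m`. -/
def level (m : ℤ) : ℝ := M.Ylo + m * M.ξ

open Classical in
/-- The index that is reached from `m` when `v.1` sell orders and `v.2` buy orders arrive; moves
that would leave `[Ylo, Yhi]` are ignored. -/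
def step (m : ℤ) (v : ℤ × ℤ) : ℤ :=
  let m' := m + (if M.level m + M.ξ ≤ M.Yhi then v.1 else 0)
    - (if M.Ylo ≤ M.level m - M.ξ then v.2 else 0)
  if M.level m' ∈ Icc M.Ylo M.Yhi then m' else m

/-- The chain of indices driven by the moves `V`. -/
def chain (m : ℤ) (V : ℕ → ℤ × ℤ) : ℕ → ℤ
  | 0 => m
  | k + 1 => M.step (chain m V k) (V k)

/-- The increments of two counting paths over the cells of a grid. -/
def incr (nb na : M.Time → ℕ) (t : M.Time) (n k : ℕ) : ℤ × ℤ :=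
  ((nb (M.grid t n (k + 1)) : ℤ) - nb (M.grid t n k),
    (na (M.grid t n (k + 1)) : ℤ) - na (M.grid t n k))

variable {M}

lemma step_mem {m : ℤ} (hm : M.level m ∈ Icc M.Ylo M.Yhi) (v : ℤ × ℤ) :
    M.level (M.step m v) ∈ Icc M.Ylo M.Yhi := by
  simp only [step]
  split_ifs with h <;> assumption

lemma chain_mem {m : ℤ} (hm : M.level m ∈ Icc M.Ylo M.Yhi) (V : ℕ → ℤ × ℤ) (k : ℕ) :
    M.level (M.chain m V k) ∈ Icc M.Ylo M.Yhi := by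
  induction k with
  | zero => exact hm
  | succ k ih => exact step_mem ih _

open Classical in
-- Moves of size zero or one never trigger the outer test in `step`. That test only matters for
-- other moves, such as several orders in one cell; it makes `chain_mem` valid for every sequence of
-- moves, without exceptional sets.
lemma level_step {m : ℤ} (hm : M.level m ∈ Icc M.Ylo M.Yhi) {v : ℤ × ℤ}
    (h1 : (v.1 : ℝ) = 0 ∨ (v.1 : ℝ) = 1) (h2 : (v.2 : ℝ) = 0 ∨ (v.2 : ℝ) = 1) :
    M.level (M.step m v) =
      M.level m + M.ξ * ((if M.level m + M.ξ ≤ M.Yhi then 1 else 0) * (v.1 : ℝ))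
        - M.ξ * ((if M.Ylo ≤ M.level m - M.ξ then 1 else 0) * (v.2 : ℝ)) := by
  have hx := M.ξ_pos
  obtain ⟨hl, hu⟩ := hm
  have key : ∀ b a : ℤ, M.level (m + b - a) = M.level m + (M.ξ * b - M.ξ * a) := fun b a => by
    simp only [level]
    push_cast
    ring
  have hstep : ∀ b a : ℤ,
      (M.level m + M.ξ ≤ M.Yhi ∧ ((b : ℝ) = 0 ∨ (b : ℝ) = 1) ∨ (b : ℝ) = 0) →
      (M.Ylo ≤ M.level m - M.ξ ∧ ((a : ℝ) = 0 ∨ (a : ℝ) = 1) ∨ (a : ℝ) = 0) →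
      M.level (m + b - a) ∈ Icc M.Ylo M.Yhi := by
    intro b a hb ha
    rw [key]
    constructor <;> rcases hb with ⟨hb, hb' | hb'⟩ | hb' <;> rcases ha with ⟨ha, ha' | ha'⟩ | ha' <;>
      rw [hb', ha'] <;> linarith
  rw [add_sub_assoc]
  by_cases hb : M.level m + M.ξ ≤ M.Yhi <;> by_cases ha : M.Ylo ≤ M.level m - M.ξ
  · have := hstep v.1 v.2 (Or.inl ⟨hb, h1⟩) (Or.inl ⟨ha, h2⟩)
    simp only [step, hb, ha, if_true, one_mul]
    rw [if_pos this, key]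
  · have := hstep v.1 0 (Or.inl ⟨hb, h1⟩) (Or.inr Int.cast_zero)
    simp only [step, hb, ha, if_true, if_false, one_mul, zero_mul]
    rw [if_pos this, key, Int.cast_zero]
  · have := hstep 0 v.2 (Or.inr Int.cast_zero) (Or.inl ⟨ha, h2⟩)
    simp only [step, hb, ha, if_true, if_false, one_mul, zero_mul]
    rw [if_pos this, key, Int.cast_zero]
  · have := hstep 0 0 (Or.inr Int.cast_zero) (Or.inr Int.cast_zero)
    simp only [step, hb, ha, if_false, zero_mul]
    rw [if_pos this, key, Int.cast_zero]

/-- The jumps on `(t, T]` have size one. -/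
def HasUnitJumps (t : M.Time) (n : M.Time → ℕ) : Prop :=
  ∀ s, t < s → M.jump n s = 0 ∨ M.jump n s = 1

/-! ### Grids that separate the jumps -/

section Path

variable {nb na : M.Time → ℕ} (hb : M.IsCadlagPath nb) (ha : M.IsCadlagPath na) {t : M.Time}

include hb ha

lemma mem_jumpTimes_Ioi {s : M.Time} : s ∈ M.jumpTimes nb na (Ioi t) ↔
    t < s ∧ (M.jump nb s ≠ 0 ∨ M.jump na s ≠ 0) := M.mem_jumpTimes hb ha _ _

lemma eventually_injOn_idx_jumpTimes :
    ∀ᶠ n in atTop, Set.InjOn (M.idx t n) (M.jumpTimes nb na (Ioi t) : Set M.Time) :=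
  eventually_injOn_idx t _ fun _ hs => ((mem_jumpTimes_Ioi hb ha).1 hs).1

omit hb ha in
lemma filter_idx_eq {n : ℕ} (hinj : Set.InjOn (M.idx t n) (M.jumpTimes nb na (Ioi t) : Set M.Time))
    (k : ℕ) : ((M.jumpTimes nb na (Ioi t)).filter (fun s => M.idx t n s = k) = ∅) ∨
      ∃ s, (M.jumpTimes nb na (Ioi t)).filter (fun s => M.idx t n s = k) = {s} := by
  rw [← Finset.card_eq_zero, ← Finset.card_eq_one]
  have : ((M.jumpTimes nb na (Ioi t)).filter (fun s => M.idx t n s = k)).card ≤ 1 := by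
    rw [Finset.card_le_one]
    intro r hr s hs
    rw [Finset.mem_filter] at hr hs
    exact hinj hr.1 hs.1 (hr.2.trans hs.2.symm)
  omega

/-- Here `n'` stands for either of the two paths; a cell holds at most one jump time of the pair, so
the sum has at most one term. -/
lemma sub_grid_eq_sum_jump {n' : M.Time → ℕ} (hn' : M.IsCadlagPath n')
    (hsub : ∀ s, M.jump n' s ≠ 0 → M.jump nb s ≠ 0 ∨ M.jump na s ≠ 0) {n : ℕ}
    (hinj : Set.InjOn (M.idx t n) (M.jumpTimes nb na (Ioi t) : Set M.Time)) (k : ℕ) :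
    (n' (M.grid t n (k + 1)) : ℝ) - n' (M.grid t n k) =
      ∑ s ∈ (M.jumpTimes nb na (Ioi t)).filter (fun s => M.idx t n s = k), M.jump n' s := by
  have hmem : ∀ s ∈ Ioc (M.grid t n k) (M.grid t n (k + 1)), M.jump n' s ≠ 0 →
      s ∈ (M.jumpTimes nb na (Ioi t)).filter (fun s => M.idx t n s = k) := fun s hs hj =>
    Finset.mem_filter.2 ⟨(mem_jumpTimes_Ioi hb ha).2
      ⟨(le_grid t n k).trans_lt hs.1, hsub s hj⟩, idx_eq hs⟩
  rcases filter_idx_eq hinj k with h | ⟨s, h⟩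
  · rw [h, Finset.sum_empty, sub_eq_zero]
    congr 1
    refine (hn'.eq_of_jump_eq_zero (grid_mono t n k.le_succ) fun s hs => ?_).symm
    by_contra hj
    have := hmem s hs hj
    rw [h] at this
    exact absurd this (Finset.notMem_empty s)
  · rw [h, Finset.sum_singleton]
    have hs : s ∈ (M.jumpTimes nb na (Ioi t)).filter (fun s => M.idx t n s = k) := by
      rw [h]; exact Finset.mem_singleton_self s
    rw [Finset.mem_filter, mem_jumpTimes_Ioi hb ha] at hs
    have hcell := (idx_spec hs.1.1 n).2
    rw [hs.2] at hcell
    refine hn'.sub_eq_jump hcell fun r hr hrs => ?_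
    by_contra hj
    have := hmem r hr hj
    rw [h, Finset.mem_singleton] at this
    exact hrs this

/-- Regrouping by jump times gives an index set that does not depend on `n`, so that the limit can
be taken term by term. -/
lemma sum_mul_sub_grid {n' : M.Time → ℕ} (hn' : M.IsCadlagPath n')
    (hsub : ∀ s, M.jump n' s ≠ 0 → M.jump nb s ≠ 0 ∨ M.jump na s ≠ 0) {n : ℕ}
    (hinj : Set.InjOn (M.idx t n) (M.jumpTimes nb na (Ioi t) : Set M.Time)) (F : ℕ → ℝ) :
    ∑ k ∈ Finset.range (n + 1), F k * ((n' (M.grid t n (k + 1)) : ℝ) - n' (M.grid t n k)) =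
      ∑ s ∈ M.jumpTimes nb na (Ioi t), F (M.idx t n s) * M.jump n' s := by
  rw [← Finset.sum_fiberwise_of_maps_to (t := Finset.range (n + 1)) (g := M.idx t n)
    fun s hs => Finset.mem_range.2 (idx_spec ((mem_jumpTimes_Ioi hb ha).1 hs).1 n).1]
  refine Finset.sum_congr rfl fun k _ => ?_
  rw [sub_grid_eq_sum_jump hb ha hn' hsub hinj, Finset.mul_sum]
  refine Finset.sum_congr rfl fun s hs => ?_
  rw [(Finset.mem_filter.1 hs).2]

lemma jumpTimes_Ioc_grid_succ (n k : ℕ) [DecidableEq M.Time] :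
    M.jumpTimes nb na (Ioc t (M.grid t n (k + 1))) = M.jumpTimes nb na (Ioc t (M.grid t n k)) ∪
      (M.jumpTimes nb na (Ioi t)).filter (fun s => M.idx t n s = k) := by
  ext s
  rw [Finset.mem_union, Finset.mem_filter, mem_jumpTimes_Ioi hb ha, M.mem_jumpTimes hb ha,
    M.mem_jumpTimes hb ha]
  constructor
  · rintro ⟨h1, h2⟩
    by_cases h : s ≤ M.grid t n k
    · exact Or.inl ⟨⟨h1.1, h⟩, h2⟩
    · exact Or.inr ⟨⟨h1.1, h2⟩, idx_eq ⟨not_le.1 h, h1.2⟩⟩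
  · rintro (⟨h1, h2⟩ | ⟨⟨h1, h2⟩, h3⟩)
    · exact ⟨⟨h1.1, h1.2.trans (grid_mono t n k.le_succ)⟩, h2⟩
    · have := (idx_spec h1 n).2.2
      rw [h3] at this
      exact ⟨⟨h1, this⟩, h2⟩

/-- On a grid that separates the jumps, the chain is the reserve. -/
lemma reserve_grid_eq (hub : HasUnitJumps t nb) (hua : HasUnitJumps t na) {m : ℤ}
    (hm : M.level m ∈ Icc M.Ylo M.Yhi) {n : ℕ}
    (hinj : Set.InjOn (M.idx t n) (M.jumpTimes nb na (Ioi t) : Set M.Time)) (k : ℕ) :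
    M.reserve nb na t (M.level m) (M.grid t n k) =
      M.level (M.chain m (M.incr nb na t n) k) := by
  classical
  induction k with
  | zero =>
    have : M.jumpTimes nb na (Ioc t (M.grid t n 0)) = ∅ := by
      ext s
      simp [M.mem_jumpTimes hb ha, grid_zero]
    rw [reserve, this]
    simp [runJumps, chain]
  | succ k ih =>
    have hsubb := sub_grid_eq_sum_jump hb ha hb (fun s h => Or.inl h) hinj k
    have hsuba := sub_grid_eq_sum_jump hb ha ha (fun s h => Or.inr h) hinj k
    rw [reserve, jumpTimes_Ioc_grid_succ hb ha, chain]
    rw [reserve] at ih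
    set m' := M.chain m (M.incr nb na t n) k with hm'
    have hmem : M.level m' ∈ Icc M.Ylo M.Yhi := chain_mem hm _ k
    rcases filter_idx_eq hinj k with h | ⟨s, h⟩
    · rw [h, Finset.sum_empty] at hsubb hsuba
      have hv : M.incr nb na t n k = 0 := by
        refine Prod.ext ?_ ?_
        · have : ((nb (M.grid t n (k + 1)) : ℤ) : ℝ) - ((nb (M.grid t n k) : ℤ) : ℝ) = 0 := by
            simpa using hsubb
          exact Int.cast_injective (α := ℝ) (by simpa [incr] using this)
        · have : ((na (M.grid t n (k + 1)) : ℤ) : ℝ) - ((na (M.grid t n k) : ℤ) : ℝ) = 0 := by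
            simpa using hsuba
          exact Int.cast_injective (α := ℝ) (by simpa [incr] using this)
      rw [h, Finset.union_empty, ih, hv]
      simp [step]
    · rw [h, Finset.sum_singleton] at hsubb hsuba
      have hs : s ∈ (M.jumpTimes nb na (Ioi t)).filter (fun s => M.idx t n s = k) := by
        rw [h]; exact Finset.mem_singleton_self s
      rw [Finset.mem_filter, mem_jumpTimes_Ioi hb ha] at hs
      have hcell := (idx_spec hs.1.1 n).2
      rw [hs.2] at hcell
      have hlast : ∀ r ∈ M.jumpTimes nb na (Ioc t (M.grid t n k)), r < s := fun r hr =>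
        ((M.mem_jumpTimes hb ha _ _).1 hr).1.2.trans_lt hcell.1
      rw [h, Finset.union_comm, ← Finset.insert_eq, M.runJumps_insert_max _ _ _ _ _ hlast, ih,
        reserveIncrement, ← hsubb, ← hsuba]
      have hvb : ((M.incr nb na t n k).1 : ℝ) =
          (nb (M.grid t n (k + 1)) : ℝ) - nb (M.grid t n k) := by simp [incr]
      have hva : ((M.incr nb na t n k).2 : ℝ) =
          (na (M.grid t n (k + 1)) : ℝ) - na (M.grid t n k) := by simp [incr]
      have h01 : ((M.incr nb na t n k).1 : ℝ) = 0 ∨ ((M.incr nb na t n k).1 : ℝ) = 1 := by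
        rw [hvb, hsubb]; exact hub s hs.1.1
      have h02 : ((M.incr nb na t n k).2 : ℝ) = 0 ∨ ((M.incr nb na t n k).2 : ℝ) = 1 := by
        rw [hva, hsuba]; exact hua s hs.1.1
      rw [← hvb, ← hva]
      generalize M.incr nb na t n k = v at *
      rw [level_step hmem h01 h02, add_sub_assoc]

/-- The reserve just before `u` is eventually the chain at the left end of the cell of `u`. -/
lemma eventually_reserveLeft_eq (hub : HasUnitJumps t nb) (hua : HasUnitJumps t na) {m : ℤ}
    (hm : M.level m ∈ Icc M.Ylo M.Yhi) {u : M.Time} (hu : t < u) :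
    ∀ᶠ n in atTop, M.reserveLeft nb na t (M.level m) u =
      M.level (M.chain m (M.incr nb na t n) (M.idx t n u)) := by
  classical
  -- With `u` added to the separated points, no jump strictly before `u` lies in its cell, so the
  -- reserve at the left end is already the value just before `u`, whether or not `u` is a jump
  -- time.
  have h := eventually_injOn_idx t (insert u (M.jumpTimes nb na (Ioi t))) (by
    intro s hs
    rcases Finset.mem_insert.1 hs with rfl | hs
    · exact hu
    · exact ((mem_jumpTimes_Ioi hb ha).1 hs).1)
  filter_upwards [h] with n hn
  have hinj : Set.InjOn (M.idx t n) (M.jumpTimes nb na (Ioi t) : Set M.Time) :=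
    hn.mono (by simp)
  rw [← reserve_grid_eq hb ha hub hua hm hinj, reserveLeft, reserve]
  congr 1
  ext r
  rw [M.mem_jumpTimes hb ha, M.mem_jumpTimes hb ha]
  have hu2 := (idx_spec hu n).2
  constructor
  · rintro ⟨h1, h2⟩
    refine ⟨⟨h1.1, ?_⟩, h2⟩
    by_contra hlt
    have hr : M.idx t n r = M.idx t n u := idx_eq ⟨not_le.1 hlt, h1.2.le.trans hu2.2⟩
    have hrJ : r ∈ M.jumpTimes nb na (Ioi t) := (mem_jumpTimes_Ioi hb ha).2 ⟨h1.1, h2⟩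
    exact h1.2.ne (hn (by simp [hrJ]) (by simp) hr)
  · rintro ⟨h1, h2⟩
    exact ⟨⟨h1.1, h1.2.trans_lt hu2.1⟩, h2⟩

end Path

/-! ### Riemann sums -/

lemma lebesgue_apply (A : Set M.Time) : M.lebesgue A = volume (Subtype.val '' A) :=
  (MeasurableEmbedding.subtype_coe measurableSet_Icc).comap_apply _ _

lemma lebesgue_Ioc (u v : M.Time) : M.lebesgue (Ioc u v) = ENNReal.ofReal ((v : ℝ) - u) := by
  have : Subtype.val '' Ioc u v = Ioc (u : ℝ) v := by
    ext x
    constructor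
    · rintro ⟨z, hz, rfl⟩
      exact hz
    · intro hx
      exact ⟨⟨x, u.2.1.trans hx.1.le, hx.2.trans v.2.2⟩, hx, rfl⟩
  rw [lebesgue_apply, this, Real.volume_Ioc]

lemma lebesgue_univ : M.lebesgue univ = ENNReal.ofReal M.T := by
  rw [lebesgue_apply, image_univ, Subtype.range_coe, Real.volume_Icc, sub_zero]

instance : IsFiniteMeasure M.lebesgue := ⟨by rw [lebesgue_univ]; exact ENNReal.ofReal_lt_top⟩

/-- A Riemann sum is the integral of a step function; in this form dominated convergence applies to
the compensator. -/
lemma setIntegral_idx (t : M.Time) (n : ℕ) (F : ℕ → ℝ) :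
    ∫ u in Ioi t, F (M.idx t n u) ∂M.lebesgue = ∑ k ∈ Finset.range (n + 1), F k * M.mesh t n := by
  have h1 : ∫ u in Ioi t, F (M.idx t n u) ∂M.lebesgue =
      ∫ u in Ioi t, ∑ k ∈ Finset.range (n + 1),
        (Ioc (M.grid t n k) (M.grid t n (k + 1))).indicator (fun _ => F k) u ∂M.lebesgue := by
    refine setIntegral_congr_fun measurableSet_Ioi fun u hu => ?_
    obtain ⟨h1, h2⟩ := idx_spec hu n
    rw [Finset.sum_eq_single_of_mem _ (Finset.mem_range.2 h1), indicator_of_mem h2]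
    intro k _ hk
    exact indicator_of_notMem (fun h => hk (idx_eq h).symm) _
  rw [h1, integral_finsetSum]
  · refine Finset.sum_congr rfl fun k hk => ?_
    rw [integral_indicator_const _ measurableSet_Ioc, measureReal_restrict_apply measurableSet_Ioc,
      inter_eq_left.2 (Ioc_subset_Ioi_self.trans (Ioi_subset_Ioi (le_grid t n k))), Measure.real, lebesgue_Ioc,
      coe_grid_succ_sub t (Finset.mem_range.1 hk), ENNReal.toReal_ofReal (mesh_nonneg t n),
      smul_eq_mul, mul_comm]
  · intro k _
    exact (integrable_const _).indicator measurableSet_Ioc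

end AMM.Model
end

noncomputable section

namespace AMM

open scoped NNReal ENNReal

/-! ### Poisson laws -/

/-- The exponential series. It serves twice: to normalise the one-cell likelihood ratio and to make
the majorant of the densities integrable. -/
lemma lintegral_exp_poissonMeasure (r : ℝ≥0) (x : ℝ) :
    ∫⁻ b, ENNReal.ofReal (Real.exp (x * b)) ∂((poissonMeasure r).map (Nat.cast : ℕ → ℤ)) =
      ENNReal.ofReal (Real.exp (r * (Real.exp x - 1))) := by
  rw [lintegral_map (Measurable.of_discrete) (Measurable.of_discrete), poissonMeasure,
    lintegral_sum_measure]
  simp only [lintegral_smul_measure, lintegral_dirac, smul_eq_mul, Int.cast_natCast]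
  have hs : HasSum (fun k : ℕ => Real.exp (-r) * r ^ k / k.factorial * Real.exp (x * k))
      (Real.exp (r * (Real.exp x - 1))) := by
    have h := (NormedSpace.expSeries_div_hasSum_exp (𝔸 := ℝ) ((r : ℝ) * Real.exp x)).mul_left
      (Real.exp (-r))
    rw [← Real.exp_eq_exp_ℝ, ← Real.exp_add] at h
    have he : Real.exp (r * (Real.exp x - 1)) = Real.exp (-r + r * Real.exp x) := by ring_nf
    rw [he]
    refine h.congr_fun ?_
    intro k
    rw [mul_pow, ← Real.exp_nat_mul, mul_comm x]
    ring
  rw [← hs.tsum_eq, ENNReal.ofReal_tsum_of_nonneg (fun k => by positivity) hs.summable]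
  exact tsum_congr fun k => (ENNReal.ofReal_mul (by positivity)).symm

/-- From `exp (-r) ≥ 1 - r`, the mass is `1 - exp (-r) * (1 + r) ≤ 1 - (1 - r) * (1 + r)`. The
quadratic order makes the sum over all cells vanish with the mesh. -/
lemma poissonMeasure_two_le (r : ℝ≥0) :
    (poissonMeasure r).map (Nat.cast : ℕ → ℤ) {b | 2 ≤ b} ≤ ENNReal.ofReal ((r : ℝ) ^ 2) := by
  rw [Measure.map_apply Measurable.of_discrete (MeasurableSet.of_discrete)]
  have hset : (Nat.cast : ℕ → ℤ) ⁻¹' {b | 2 ≤ b} = ({0, 1} : Set ℕ)ᶜ := by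
    ext k
    simp only [mem_preimage, mem_ofPred_eq, mem_compl_iff, mem_insert_iff, mem_singleton_iff]
    omega
  rw [hset, ← ofReal_measureReal, probReal_compl_eq_one_sub MeasurableSet.of_discrete,
    show ({0, 1} : Set ℕ) = {0} ∪ {1} from rfl,
    measureReal_union (by simp) MeasurableSet.of_discrete,
    poissonMeasure_real_singleton, poissonMeasure_real_singleton]
  refine ENNReal.ofReal_le_ofReal ?_
  have h := Real.add_one_le_exp (-(r : ℝ))
  have hr : (0 : ℝ) ≤ r := r.2
  simp only [pow_zero, mul_one, Nat.factorial_zero, Nat.cast_one, div_one, pow_one,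
    Nat.factorial_one]
  nlinarith

lemma poissonMeasure_neg (r : ℝ≥0) :
    (poissonMeasure r).map (Nat.cast : ℕ → ℤ) {b | b < 0} = 0 := by
  rw [Measure.map_apply Measurable.of_discrete (MeasurableSet.of_discrete)]
  have hset : (Nat.cast : ℕ → ℤ) ⁻¹' {b | b < 0} = ∅ := by
    ext k
    simp
  rw [hset, measure_empty]

/-! ### Independence -/

section Independence

variable {Ω α β γ δ : Type*} [mΩ : MeasurableSpace Ω] [MeasurableSpace α] [MeasurableSpace β]
  [MeasurableSpace γ] [MeasurableSpace δ] {P : Measure Ω} [IsProbabilityMeasure P]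
  {X : Ω → α} {U : Ω → β} {V : Ω → γ} {Z : Ω → δ}

lemma indepFun_prodMk_left (hX : Measurable X) (hU : Measurable U) (hV : Measurable V)
    (h : IndepFun X (fun ω => (U ω, V ω)) P) (hUV : IndepFun U V P) :
    IndepFun (fun ω => (X ω, U ω)) V P := by
  have hXU : IndepFun X U P := h.comp measurable_id measurable_fst
  rw [indepFun_iff_map_prod_eq_prod_map_map (hX.prodMk hU).aemeasurable hV.aemeasurable,
    (indepFun_iff_map_prod_eq_prod_map_map hX.aemeasurable hU.aemeasurable).1 hXU]
  have := (indepFun_iff_map_prod_eq_prod_map_map hX.aemeasurable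
    (hU.prodMk hV).aemeasurable).1 h
  rw [(indepFun_iff_map_prod_eq_prod_map_map hU.aemeasurable hV.aemeasurable).1 hUV] at this
  have hassoc := Measure.prodAssoc_prod (μ := P.map X) (ν := P.map U) (τ := P.map V)
  rw [← this] at hassoc
  have h2 := congrArg (Measure.map MeasurableEquiv.prodAssoc.symm) hassoc
  rw [MeasurableEquiv.map_symm_map] at h2
  rw [h2, Measure.map_map MeasurableEquiv.prodAssoc.symm.measurable (hX.prodMk (hU.prodMk hV))]
  rfl

/-- The four variables are mutually independent, so they may be regrouped: from process by process
to past against present. -/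
lemma indepFun_prodMk_prodMk (hX : Measurable X) (hU : Measurable U) (hV : Measurable V)
    (hZ : Measurable Z) (h : IndepFun (fun ω => (X ω, V ω)) (fun ω => (U ω, Z ω)) P)
    (hXV : IndepFun X V P) (hUZ : IndepFun U Z P) :
    IndepFun (fun ω => (X ω, U ω)) (fun ω => (V ω, Z ω)) P := by
  have h1 : IndepFun (fun ω => ((X ω, V ω), U ω)) Z P :=
    indepFun_prodMk_left (hX.prodMk hV) hU hZ h hUZ
  have h2 : IndepFun (fun ω => (U ω, X ω)) V P :=
    indepFun_prodMk_left hU hX hV (h.symm.comp measurable_fst measurable_id) hXV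
  have h3 : IndepFun Z (fun ω => (V ω, (X ω, U ω))) P :=
    h1.symm.comp measurable_id (ψ := fun p : (α × γ) × β => (p.1.2, (p.1.1, p.2))) (by fun_prop)
  have h4 : IndepFun V (fun ω => (X ω, U ω)) P := (h2.comp measurable_swap measurable_id).symm
  exact (indepFun_prodMk_left hZ hV (hX.prodMk hU) h3 h4).symm.comp measurable_id measurable_swap

/-- Tonelli for the product law: an independent variable is integrated out with the other one
frozen. -/
lemma lintegral_comp_of_indepFun (hX : Measurable X) (hV : Measurable V) (h : IndepFun X V P)
    {g : α × γ → ℝ≥0∞} (hg : Measurable g) :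
    ∫⁻ ω, g (X ω, V ω) ∂P = ∫⁻ ω, ∫⁻ v, g (X ω, v) ∂(P.map V) ∂P := by
  rw [← lintegral_map (f := g) hg (hX.prodMk hV),
    (indepFun_iff_map_prod_eq_prod_map_map hX.aemeasurable hV.aemeasurable).1 h,
    lintegral_prod _ hg.aemeasurable,
    lintegral_map (f := fun x => ∫⁻ v, g (x, v) ∂(P.map V)) hg.lintegral_prod_right' hX]

end Independence

/-- A product of one-step densities integrates to one against everything that is known at time
`0`. -/
lemma lintegral_mul_prod_of_indep {Ω γ : Type*} [mΩ : MeasurableSpace Ω] [MeasurableSpace γ]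
    [Countable γ] [MeasurableSingletonClass γ]
    {P : Measure Ω} [IsProbabilityMeasure P] (F : ℕ → MeasurableSpace Ω) (hF : Monotone F)
    (hle : ∀ k, F k ≤ mΩ) (V : ℕ → Ω → γ) (hV : ∀ k, Measurable[F (k + 1)] (V k))
    (hind : ∀ k, Indep (F k) (MeasurableSpace.comap (V k) inferInstance) P)
    (f : ℕ → Ω → γ → ℝ≥0∞) (hf : ∀ k v, Measurable[F k] fun ω => f k ω v)
    {N : ℕ} (hint : ∀ k < N, ∀ ω, ∫⁻ v, f k ω v ∂(P.map (V k)) = 1) {H : Ω → ℝ≥0∞}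
    (hH : Measurable[F 0] H) :
    ∫⁻ ω, H ω * ∏ k ∈ Finset.range N, f k ω (V k ω) ∂P = ∫⁻ ω, H ω ∂P := by
  -- Joint measurability comes from the countability of the space of moves.
  have hjoint : ∀ k, Measurable[(F k).prod inferInstance] fun p : Ω × γ => f k p.1 p.2 := fun k =>
    @measurable_from_prod_countable_left Ω γ ℝ≥0∞ (F k) _ _ _ _ _ (hf k)
  have hmeas : ∀ n, Measurable[F n] fun ω => H ω * ∏ k ∈ Finset.range n, f k ω (V k ω) := by
    intro n
    refine Measurable.mul (hH.mono (hF (Nat.zero_le n)) le_rfl) ?_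
    refine Finset.measurable_fun_prod _ fun k hk => ?_
    have hkn : k + 1 ≤ n := Finset.mem_range.1 hk
    have hpair : @Measurable _ _ (F n) ((F k).prod inferInstance) fun ω => (ω, V k ω) :=
      @Measurable.prodMk Ω (F n) Ω γ (F k) _ _ _
        (measurable_id'' (hF (k.le_succ.trans hkn))) ((hV k).mono (hF hkn) le_rfl)
    exact (hjoint k).comp hpair
  have main : ∀ n ≤ N, ∫⁻ ω, H ω * ∏ k ∈ Finset.range n, f k ω (V k ω) ∂P = ∫⁻ ω, H ω ∂P := by
    intro n
    induction n with
    | zero => simp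
    | succ n ih =>
      intro hn
      rw [← ih (Nat.le_of_succ_le hn)]
      simp only [Finset.prod_range_succ, ← mul_assoc]
      -- The σ-algebra `F n` is encoded as the identity with values in `Ω` equipped with `F n`, so
      -- that the freezing lemma applies.
      have hi : @IndepFun Ω Ω γ mΩ (F n) _ id (V n) P := by
        refine (@IndepFun_iff_Indep Ω Ω γ mΩ (F n) _ id (V n) P).2 ?_
        rw [@MeasurableSpace.comap_id Ω (F n)]
        exact hind n
      have hg : Measurable[(F n).prod inferInstance] fun p : Ω × γ =>
          (H p.1 * ∏ k ∈ Finset.range n, f k p.1 (V k p.1)) * f n p.1 p.2 :=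
        @Measurable.mul ℝ≥0∞ (Ω × γ) _ _ ((F n).prod inferInstance) _ _ _
          ((hmeas n).comp (@measurable_fst _ _ (F n) _)) (hjoint n)
      have := @lintegral_comp_of_indepFun Ω Ω γ mΩ (F n) _ P _ id (V n)
        (measurable_id'' (hle n)) ((hV n).mono (hle _) le_rfl) hi _ hg
      simp only [id] at this
      rw [this]
      refine lintegral_congr fun ω => ?_
      rw [lintegral_const_mul _ Measurable.of_discrete, hint n hn, mul_one]
  exact main N le_rfl

end AMM
end

noncomputable section

namespace AMM.Model

open scoped NNReal ENNReal

variable {M : Model} {Ω : Type*} [mΩ : MeasurableSpace Ω] {P : Measure Ω}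

/-! ### Increments and jump sizes of Poisson processes -/

lemma measurable_path_sub (u v : M.Time) :
    Measurable fun p : M.Time → ℕ => (p u : ℤ) - p v := by
  have h : Measurable (fun p : ℕ × ℕ => (p.1 : ℤ) - p.2) := Measurable.of_discrete
  have hu : Measurable fun p : M.Time → ℕ => p u := measurable_pi_apply u
  have hv : Measurable fun p : M.Time → ℕ => p v := measurable_pi_apply v
  exact h.comp (hu.prodMk hv)

lemma IsPoisson.measurable_sub {N : M.Time → Ω → ℕ} (hN : M.IsPoisson P N) (s t : M.Time) :
    Measurable fun ω => (N t ω : ℤ) - N s ω := by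
  have h : Measurable (fun p : ℕ × ℕ => (p.1 : ℤ) - p.2) := Measurable.of_discrete
  exact h.comp ((hN.measurable t).prodMk (hN.measurable s))

lemma IsPoisson.ae_sub_nonneg {N : M.Time → Ω → ℕ} (hN : M.IsPoisson P N) {s t : M.Time}
    (h : s ≤ t) : ∀ᵐ ω ∂P, 0 ≤ (N t ω : ℤ) - N s ω := by
  rw [ae_iff]
  simp only [not_le]
  have h2 := Measure.map_apply (hN.measurable_sub s t) (μ := P) (s := {b | b < 0})
    MeasurableSet.of_discrete
  rw [(hN.law _ _ h).map_eq, poissonMeasure_neg] at h2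
  exact h2.symm

/-- Almost surely a Poisson process only has jumps of size one. -/
lemma IsPoisson.ae_hasUnitJumps {N : M.Time → Ω → ℕ} (hN : M.IsPoisson P N) (t : M.Time) :
    ∀ᵐ ω ∂P, HasUnitJumps t fun s => N s ω := by
  let X : ℕ → ℕ → Ω → ℤ := fun n k ω => (N (M.grid t n (k + 1)) ω : ℤ) - N (M.grid t n k) ω
  have hX : ∀ n k, Measurable (X n k) := fun n k => hN.measurable_sub _ _
  have hpos : ∀ᵐ ω ∂P, ∀ n k, 0 ≤ X n k ω := ae_all_iff.2 fun n => ae_all_iff.2 fun k =>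
    hN.ae_sub_nonneg (grid_mono t n k.le_succ)
  -- Some cell sees at least two arrivals: `n + 1` cells of probability at most a multiple of the
  -- squared mesh, a total of the order of the mesh.
  let E : ℕ → Set Ω := fun n => ⋃ k ∈ Finset.range (n + 1), {ω | 2 ≤ X n k ω}
  have hE : ∀ n, P (E n) ≤ ENNReal.ofReal ((n + 1) * (M.a0 * M.mesh t n) ^ 2) := by
    intro n
    refine (measure_biUnion_finset_le _ _).trans ?_
    have : ∀ k ∈ Finset.range (n + 1),
        P {ω | 2 ≤ X n k ω} ≤ ENNReal.ofReal ((M.a0 * M.mesh t n) ^ 2) := by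
      intro k hk
      have h := (hN.law _ _ (grid_mono t n k.le_succ)).map_eq
      rw [coe_grid_succ_sub t (Finset.mem_range.1 hk)] at h
      have h2 := Measure.map_apply (hX n k) (μ := P) (s := {b | 2 ≤ b}) MeasurableSet.of_discrete
      rw [h] at h2
      refine h2.symm.le.trans ((poissonMeasure_two_le _).trans ?_)
      rw [Real.coe_toNNReal _ (mul_nonneg M.a0_pos.le (mesh_nonneg t n))]
    refine (Finset.sum_le_sum this).trans ?_
    rw [Finset.sum_const, Finset.card_range, nsmul_eq_mul, ENNReal.ofReal_mul (by positivity)]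
    gcongr
    rw [← Nat.cast_succ, ENNReal.ofReal_natCast]
  have hlim : Tendsto (fun n : ℕ => ENNReal.ofReal ((n + 1) * (M.a0 * M.mesh t n) ^ 2)) atTop
      (𝓝 0) := by
    have h1 : Tendsto (fun n : ℕ => M.a0 ^ 2 * (M.T - t) * M.mesh t n) atTop (𝓝 0) := by
      simpa using (tendsto_mesh t).const_mul (M.a0 ^ 2 * (M.T - t))
    have h2 : (fun n : ℕ => M.a0 ^ 2 * (M.T - t) * M.mesh t n) =
        fun n : ℕ => ((n : ℝ) + 1) * (M.a0 * M.mesh t n) ^ 2 := by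
      funext n
      rw [mesh]
      field_simp
    rw [h2] at h1
    simpa using ENNReal.tendsto_ofReal h1
  -- No summability is needed: outside this null set `E n` fails for infinitely many `n`, and one of
  -- them can be taken so large that the grid also separates the jumps.
  have hnull : P (⋃ m, ⋂ n ≥ m, E n) = 0 := by
    rw [measure_iUnion_null_iff]
    intro m
    refine le_antisymm (ge_of_tendsto hlim ?_) zero_le
    filter_upwards [eventually_ge_atTop m] with n hn
    exact (measure_mono (iInter₂_subset n hn)).trans (hE n)
  filter_upwards [hpos, measure_eq_zero_iff_ae_notMem.1 hnull] with ω h1 h2 s hs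
  have hc := hN.cadlag ω
  have hinj := eventually_injOn_idx_jumpTimes hc hc (t := t)
  by_cases hj : M.jump (fun s => N s ω) s = 0
  · exact Or.inl hj
  right
  have hcell : ∀ n, Set.InjOn (M.idx t n) (M.jumpTimes (fun s => N s ω) (fun s => N s ω)
      (Ioi t) : Set M.Time) → (X n (M.idx t n s) ω : ℝ) = M.jump (fun s => N s ω) s := by
    intro n hn
    have h := sub_grid_eq_sum_jump hc hc hc (fun s h => Or.inl h) hn (M.idx t n s)
    have hmem : s ∈ (M.jumpTimes (fun s => N s ω) (fun s => N s ω) (Ioi t)).filter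
        (fun r => M.idx t n r = M.idx t n s) :=
      Finset.mem_filter.2 ⟨(mem_jumpTimes_Ioi hc hc).2 ⟨hs, Or.inl hj⟩, rfl⟩
    rcases filter_idx_eq hn (M.idx t n s) with h' | ⟨r, h'⟩
    · rw [h'] at hmem
      exact absurd hmem (Finset.notMem_empty s)
    · have hrs : s = r := by
        rw [h'] at hmem
        exact Finset.mem_singleton.1 hmem
      rw [h', Finset.sum_singleton, ← hrs] at h
      rw [← h]
      simp [X]
  obtain ⟨m, hm⟩ := eventually_atTop.1 hinj
  have h3 : ¬ ∀ n ≥ m, ω ∈ E n := fun h => h2 (mem_iUnion.2 ⟨m, mem_iInter₂.2 h⟩)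
  push Not at h3
  obtain ⟨n, hn, hnE⟩ := h3
  have h4 : X n (M.idx t n s) ω < 2 := by
    by_contra hlt
    exact hnE (mem_iUnion₂.2 ⟨_, Finset.mem_range.2 (idx_spec hs n).1, not_lt.1 hlt⟩)
  have h5 := hcell n (hm n hn)
  have h6 := h1 n (M.idx t n s)
  have h7 : X n (M.idx t n s) ω ≠ 0 := fun h => hj (by rw [← h5, h, Int.cast_zero])
  have h8 : X n (M.idx t n s) ω = 1 := by omega
  rw [← h5, h8, Int.cast_one]

/-! ### The Brownian path and the past moves -/

namespace Driver

variable (D : M.Driver P)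

/-- The path of the Brownian motion. -/
def pathW (ω : Ω) : M.Time → ℝ := fun s => D.W s ω

/-- The increments of the order flow over a cell. -/
def moves (t : M.Time) (n k : ℕ) (ω : Ω) : ℤ × ℤ :=
  M.incr (fun s => D.Nb s ω) (fun s => D.Na s ω) t n k

/-- The increments of the order flow over the first `k` cells, together with the whole path of the
Brownian motion. -/
def pastMap (t : M.Time) (n k : ℕ) (ω : Ω) :
    (M.Time → ℝ) × (Finset.range k → ℤ) × (Finset.range k → ℤ) :=
  (D.pathW ω, fun j => (D.moves t n j ω).1, fun j => (D.moves t n j ω).2)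

/-- The σ-algebra generated by the path of the Brownian motion and the order flow over the first `k`
cells of a grid. -/
@[reducible] def past (t : M.Time) (n k : ℕ) : MeasurableSpace Ω :=
  MeasurableSpace.comap (D.pastMap t n k) inferInstance

lemma measurable_pathW : Measurable D.pathW := measurable_pi_lambda _ D.brownian.measurable

lemma measurable_moves (t : M.Time) (n k : ℕ) : Measurable (D.moves t n k) :=
  (D.poissonB.measurable_sub _ _).prodMk (D.poissonA.measurable_sub _ _)

lemma measurable_pastMap (t : M.Time) (n k : ℕ) : Measurable (D.pastMap t n k) :=
  D.measurable_pathW.prodMk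
    ((measurable_pi_lambda (fun ω (j : Finset.range k) => (D.moves t n j ω).1) fun j =>
      (D.measurable_moves t n j).fst).prodMk
    (measurable_pi_lambda (fun ω (j : Finset.range k) => (D.moves t n j ω).2) fun j =>
      (D.measurable_moves t n j).snd))

lemma past_le (t : M.Time) (n k : ℕ) : D.past t n k ≤ mΩ := (D.measurable_pastMap t n k).comap_le

lemma measurable_moves_past (t : M.Time) (n : ℕ) {j k : ℕ} (h : j < k) :
    Measurable[D.past t n k] (D.moves t n j) := by
  have h1 : Measurable fun p : (M.Time → ℝ) × (Finset.range k → ℤ) × (Finset.range k → ℤ) =>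
      (p.2.1 ⟨j, Finset.mem_range.2 h⟩, p.2.2 ⟨j, Finset.mem_range.2 h⟩) := by fun_prop
  exact h1.comp (comap_measurable (D.pastMap t n k))

lemma measurable_pathW_past (t : M.Time) (n k : ℕ) : Measurable[D.past t n k] D.pathW :=
  measurable_fst.comp (comap_measurable (D.pastMap t n k))

lemma past_mono (t : M.Time) (n : ℕ) : Monotone (D.past t n) := by
  intro j k hjk
  refine Measurable.comap_le ?_
  refine Measurable.prodMk (D.measurable_pathW_past t n k) (Measurable.prodMk ?_ ?_)
  · exact @measurable_pi_lambda _ _ _ (D.past t n k) _ _ fun i =>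
      (D.measurable_moves_past t n ((Finset.mem_range.1 i.2).trans_le hjk)).fst
  · exact @measurable_pi_lambda _ _ _ (D.past t n k) _ _ fun i =>
      (D.measurable_moves_past t n ((Finset.mem_range.1 i.2).trans_le hjk)).snd

/-- Each Poisson process has independent increments; the independence of the two processes joins the
pairs, and the independence of `W` from both adds its whole path, future included, to the past. -/
lemma indepFun_pastMap_moves [IsProbabilityMeasure P] (t : M.Time) (n k : ℕ) :
    IndepFun (D.pastMap t n k) (D.moves t n k) P := by
  have hmB : ∀ j, Measurable fun ω => (D.moves t n j ω).1 := fun j => (D.measurable_moves t n j).fst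
  have hmA : ∀ j, Measurable fun ω => (D.moves t n j ω).2 := fun j => (D.measurable_moves t n j).snd
  have hdisj : Disjoint (Finset.range k) {k} := by simp
  have hB := ((D.poissonB.indep.nat (grid_mono t n)).indepFun_finset (Finset.range k) {k} hdisj
    hmB).comp measurable_id (measurable_pi_apply ⟨k, Finset.mem_singleton_self k⟩)
  have hA := ((D.poissonA.indep.nat (grid_mono t n)).indepFun_finset (Finset.range k) {k} hdisj
    hmA).comp measurable_id (measurable_pi_apply ⟨k, Finset.mem_singleton_self k⟩)
  have hfun : Measurable fun p : M.Time → ℕ =>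
      ((fun j : Finset.range k => (p (M.grid t n (j + 1)) : ℤ) - p (M.grid t n j)),
        (p (M.grid t n (k + 1)) : ℤ) - p (M.grid t n k)) := by
    exact (measurable_pi_lambda _ fun j => measurable_path_sub _ _).prodMk
      (measurable_path_sub _ _)
  have hpB := measurable_pi_lambda (fun ω (j : Finset.range k) => (D.moves t n j ω).1) fun j => hmB j
  have hpA := measurable_pi_lambda (fun ω (j : Finset.range k) => (D.moves t n j ω).2) fun j => hmA j
  have hN := indepFun_prodMk_prodMk hpB hpA (hmB k) (hmA k) (D.indep_N.comp hfun hfun) hB hA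
  refine indepFun_prodMk_left D.measurable_pathW
    (hpB.prodMk hpA) (D.measurable_moves t n k) ?_ hN
  exact D.indep_W.comp measurable_id (ψ := fun p : (M.Time → ℕ) × (M.Time → ℕ) =>
      let f := fun p : M.Time → ℕ =>
        ((fun j : Finset.range k => (p (M.grid t n (j + 1)) : ℤ) - p (M.grid t n j)),
          (p (M.grid t n (k + 1)) : ℤ) - p (M.grid t n k))
      (((f p.1).1, (f p.2).1), ((f p.1).2, (f p.2).2)))
    ((((hfun.comp measurable_fst).fst).prodMk ((hfun.comp measurable_snd).fst)).prodMk
      (((hfun.comp measurable_fst).snd).prodMk ((hfun.comp measurable_snd).snd)))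

lemma map_moves [IsProbabilityMeasure P] (t : M.Time) {n k : ℕ} (hk : k < n + 1) :
    P.map (D.moves t n k) =
      ((poissonMeasure (M.a0 * M.mesh t n).toNNReal).map (Nat.cast : ℕ → ℤ)).prod
        ((poissonMeasure (M.a0 * M.mesh t n).toNNReal).map (Nat.cast : ℕ → ℤ)) := by
  have hB := (D.poissonB.law _ _ (grid_mono t n k.le_succ)).map_eq
  have hA := (D.poissonA.law _ _ (grid_mono t n k.le_succ)).map_eq
  rw [coe_grid_succ_sub t hk] at hB hA
  have h := (indepFun_iff_map_prod_eq_prod_map_map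
    (D.poissonB.measurable_sub (M.grid t n k) (M.grid t n (k + 1))).aemeasurable
    (D.poissonA.measurable_sub (M.grid t n k) (M.grid t n (k + 1))).aemeasurable).1
    (D.indep_N.comp (measurable_path_sub (M.grid t n (k + 1)) (M.grid t n k))
      (measurable_path_sub (M.grid t n (k + 1)) (M.grid t n k)))
  rw [hB, hA] at h
  exact h

end Driver

end AMM.Model
end

noncomputable section

namespace AMM.Model

open scoped NNReal ENNReal

variable {M : Model}

/-! ### Bounds on the intensities -/

variable (M) in
/-- A bound of the intensities, in terms of a bound of the oracle price. -/
def lamBound (s : ℝ) : ℝ := M.a0 + M.a1 + M.a2 * (M.c / M.Ylo ^ 2 + s)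

lemma a0_le_lamB (y s : ℝ) : M.a0 ≤ M.lamB y s := le_max_left _ _

lemma a0_le_lamA (y s : ℝ) : M.a0 ≤ M.lamA y s := le_max_left _ _

lemma div_sq_mem {y : ℝ} (hy : y ∈ Icc M.Ylo M.Yhi) : M.c / y ^ 2 ∈ Icc 0 (M.c / M.Ylo ^ 2) := by
  have h0 := M.Ylo_pos
  have hc := M.c_pos
  have hy0 : 0 < y := h0.trans_le hy.1
  refine ⟨by positivity, ?_⟩
  gcongr
  exact hy.1

lemma lamB_le {y s r : ℝ} (hy : y ∈ Icc M.Ylo M.Yhi) (hs : |s| ≤ r) :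
    M.lamB y s ≤ M.lamBound r := by
  have h := div_sq_mem hy
  have h2 := M.a2_nonneg
  have hs' := abs_le.1 hs
  have hm := mul_le_mul_of_nonneg_left (show M.c / y ^ 2 - s ≤ M.c / M.Ylo ^ 2 + r by
    linarith [h.2]) h2
  have hp := mul_nonneg h2 (add_nonneg (h.1.trans h.2) ((abs_nonneg s).trans hs))
  rw [lamB, lamBound]
  exact max_le (by linarith [M.a1_nonneg]) (by linarith [M.a0_pos])

lemma lamA_le {y s r : ℝ} (hy : y ∈ Icc M.Ylo M.Yhi) (hs : |s| ≤ r) :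
    M.lamA y s ≤ M.lamBound r := by
  have h := div_sq_mem hy
  have h2 := M.a2_nonneg
  have hs' := abs_le.1 hs
  have hm := mul_le_mul_of_nonneg_left (show s - M.c / y ^ 2 ≤ M.c / M.Ylo ^ 2 + r by
    linarith [h.1, h.1.trans h.2]) h2
  have hp := mul_nonneg h2 (add_nonneg (h.1.trans h.2) ((abs_nonneg s).trans hs))
  rw [lamA, lamBound]
  exact max_le (by linarith [M.a1_nonneg]) (by linarith [M.a0_pos])

lemma continuous_lamB (y : ℝ) : Continuous (M.lamB y) := by
  unfold lamB
  fun_prop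

lemma continuous_lamA (y : ℝ) : Continuous (M.lamA y) := by
  unfold lamA
  fun_prop

/-- Integer indices put the discretized reserve in a countable type, where measurability is
automatic. -/
lemma exists_level_eq {y : ℝ} (hy : y ∈ M.Q) :
    ∃ m : ℤ, y = M.level m ∧ M.level m ∈ Icc M.Ylo M.Yhi := by
  obtain ⟨k, hk, hle⟩ := hy
  have h : y = M.level k := by rw [level, hk, Int.cast_natCast]
  refine ⟨k, h, ?_, h ▸ hle⟩
  rw [← h, hk]
  have := M.ξ_pos
  have : 0 ≤ (k : ℝ) * M.ξ := by positivity
  linarith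

lemma measurable_idx (t : M.Time) (n : ℕ) : Measurable (M.idx t n) := by
  have h : Measurable fun u : M.Time => ⌈((u : ℝ) - t) / M.mesh t n⌉₊ :=
    Nat.measurable_ceil.comp ((measurable_subtype_coe.sub_const _).div_const _)
  exact (Measurable.of_discrete (f := fun k : ℕ => k - 1)).comp h

namespace Driver

variable {Ω : Type*} [mΩ : MeasurableSpace Ω] {P : Measure Ω} (D : M.Driver P)

/-! ### The discretized density -/

/-- The index of the discretized reserve. -/
def index (t : M.Time) (m : ℤ) (n k : ℕ) (ω : Ω) : ℤ := M.chain m (fun j => D.moves t n j ω) k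

/-- The discretized intensity of the sell orders. -/
def stepB (t : M.Time) (m : ℤ) (S : ℝ) (n k : ℕ) (ω : Ω) : ℝ :=
  M.lamB (M.level (D.index t m n k ω)) (D.price t S (M.grid t n k) ω)

/-- The discretized intensity of the buy orders. -/
def stepA (t : M.Time) (m : ℤ) (S : ℝ) (n k : ℕ) (ω : Ω) : ℝ :=
  M.lamA (M.level (D.index t m n k ω)) (D.price t S (M.grid t n k) ω)

/-- The logarithm of the likelihood ratio of the move `v` over the cell `k`. -/
def logRatio (t : M.Time) (m : ℤ) (S : ℝ) (n k : ℕ) (ω : Ω) (v : ℤ × ℤ) : ℝ :=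
  (Real.log (D.stepB t m S n k ω / M.a0) * v.1 - (D.stepB t m S n k ω - M.a0) * M.mesh t n) +
    (Real.log (D.stepA t m S n k ω / M.a0) * v.2 - (D.stepA t m S n k ω - M.a0) * M.mesh t n)

/-- The likelihood ratio of the move `v` over the cell `k`. -/
def ratio (t : M.Time) (m : ℤ) (S : ℝ) (n k : ℕ) (ω : Ω) (v : ℤ × ℤ) : ℝ≥0∞ :=
  ENNReal.ofReal (Real.exp (D.logRatio t m S n k ω v))

/-- The density of the discretized model. -/
def discreteDensity (t : M.Time) (m : ℤ) (S : ℝ) (n : ℕ) (ω : Ω) : ℝ≥0∞ :=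
  ∏ k ∈ Finset.range (n + 1), D.ratio t m S n k ω (D.moves t n k ω)

omit mΩ in
lemma measurable_comp_prodMk {α β γ : Type*} {m : MeasurableSpace Ω} [MeasurableSpace α]
    [MeasurableSpace β] [MeasurableSpace γ] {f : Ω → α} {g : Ω → β} (hf : Measurable[m] f)
    (hg : Measurable[m] g) {h : α × β → γ} (hh : Measurable h) :
    Measurable[m] fun ω => h (f ω, g ω) := hh.comp (hf.prodMk hg)

lemma measurable_index_past (t : M.Time) (m : ℤ) (n k : ℕ) :
    Measurable[D.past t n k] (D.index t m n k) := by
  induction k with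
  | zero => exact @measurable_const _ _ _ (D.past t n 0) m
  | succ k ih =>
    have hstep : Measurable fun p : ℤ × (ℤ × ℤ) => M.step p.1 p.2 := Measurable.of_discrete
    exact measurable_comp_prodMk (ih.mono (D.past_mono t n k.le_succ) le_rfl)
      (D.measurable_moves_past t n k.lt_succ_self) hstep

lemma measurable_price_past (t : M.Time) (S : ℝ) (n k : ℕ) (u : M.Time) :
    Measurable[D.past t n k] (D.price t S u) := by
  have h : Measurable fun w : M.Time → ℝ => S + M.σ * (w u - w t) := by fun_prop
  exact h.comp (D.measurable_pathW_past t n k)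

lemma measurable_comp_index_price_past (t : M.Time) (m : ℤ) (S : ℝ) (n k : ℕ) (u : M.Time)
    {g : ℤ → ℝ → ℝ} (hg : ∀ i, Measurable (g i)) :
    Measurable[D.past t n k] fun ω => g (D.index t m n k ω) (D.price t S u ω) := by
  have h : Measurable fun p : ℤ × ℝ => g p.1 p.2 := measurable_from_prod_countable_right hg
  exact measurable_comp_prodMk (D.measurable_index_past t m n k)
    (D.measurable_price_past t S n k u) h

lemma measurable_ratio_past (t : M.Time) (m : ℤ) (S : ℝ) (n k : ℕ) (v : ℤ × ℤ) :
    Measurable[D.past t n k] fun ω => D.ratio t m S n k ω v := by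
  have hb : Measurable[D.past t n k] (D.stepB t m S n k) :=
    D.measurable_comp_index_price_past t m S n k (M.grid t n k)
      (g := fun i => M.lamB (M.level i)) fun i => (continuous_lamB _).measurable
  have ha : Measurable[D.past t n k] (D.stepA t m S n k) :=
    D.measurable_comp_index_price_past t m S n k (M.grid t n k)
      (g := fun i => M.lamA (M.level i)) fun i => (continuous_lamA _).measurable
  have h : Measurable fun p : ℝ × ℝ => ENNReal.ofReal (Real.exp
      ((Real.log (p.1 / M.a0) * v.1 - (p.1 - M.a0) * M.mesh t n) +
        (Real.log (p.2 / M.a0) * v.2 - (p.2 - M.a0) * M.mesh t n))) := by fun_prop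
  exact measurable_comp_prodMk hb ha h

/-- Tilting a Poisson law of mean `a0 * mesh` by `log (l / a0)` produces the factor `exp ((l - a0) *
mesh)`, which the compensator cancels; the two sides factor by independence. -/
lemma lintegral_ratio [IsProbabilityMeasure P] (t : M.Time) (m : ℤ) (S : ℝ) {n k : ℕ}
    (hk : k < n + 1) (ω : Ω) :
    ∫⁻ v, D.ratio t m S n k ω v ∂(P.map (D.moves t n k)) = 1 := by
  rw [D.map_moves t hk]
  set r := (M.a0 * M.mesh t n).toNNReal with hr
  have hr' : (r : ℝ) = M.a0 * M.mesh t n :=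
    Real.coe_toNNReal _ (mul_nonneg M.a0_pos.le (mesh_nonneg t n))
  have key : ∀ l, M.a0 ≤ l → ∫⁻ b : ℤ, ENNReal.ofReal
      (Real.exp (Real.log (l / M.a0) * b - (l - M.a0) * M.mesh t n))
        ∂((poissonMeasure r).map (Nat.cast : ℕ → ℤ)) = 1 := by
    intro l hl
    have h0 := M.a0_pos
    have hl0 : 0 < l := h0.trans_le hl
    simp only [Real.exp_sub, div_eq_mul_inv (Real.exp _)]
    simp only [ENNReal.ofReal_mul (Real.exp_nonneg _)]
    rw [lintegral_mul_const _ Measurable.of_discrete, lintegral_exp_poissonMeasure,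
      ← ENNReal.ofReal_mul (Real.exp_nonneg _), ← div_eq_mul_inv, ← Real.exp_sub, hr',
      Real.exp_log (div_pos hl0 h0)]
    rw [show M.a0 * M.mesh t n * (l / M.a0 - 1) - (l - M.a0) * M.mesh t n = 0 by
      field_simp; ring, Real.exp_zero, ENNReal.ofReal_one]
  simp only [ratio, logRatio, Real.exp_add, ENNReal.ofReal_mul (Real.exp_nonneg _)]
  rw [lintegral_prod_mul (f := fun b : ℤ => ENNReal.ofReal (Real.exp
      (Real.log (D.stepB t m S n k ω / M.a0) * b - (D.stepB t m S n k ω - M.a0) * M.mesh t n)))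
    (g := fun b : ℤ => ENNReal.ofReal (Real.exp
      (Real.log (D.stepA t m S n k ω / M.a0) * b - (D.stepA t m S n k ω - M.a0) * M.mesh t n)))
    Measurable.of_discrete.aemeasurable Measurable.of_discrete.aemeasurable,
    key (D.stepB t m S n k ω) (a0_le_lamB _ _), key (D.stepA t m S n k ω) (a0_le_lamA _ _), one_mul]

/-- An event about `W` already belongs to `past t n 0`, so its indicator can be the weight in
`lintegral_mul_prod_of_indep`. -/
lemma setLIntegral_discreteDensity [IsProbabilityMeasure P] (t : M.Time) (m : ℤ) (S : ℝ) (n : ℕ)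
    {A : Set (M.Time → ℝ)} (hA : MeasurableSet A) :
    ∫⁻ ω in D.pathW ⁻¹' A, D.discreteDensity t m S n ω ∂P = P (D.pathW ⁻¹' A) := by
  have hB : MeasurableSet[D.past t n 0] (D.pathW ⁻¹' A) := D.measurable_pathW_past t n 0 hA
  have hB' : MeasurableSet (D.pathW ⁻¹' A) := D.measurable_pathW hA
  have hH : Measurable[D.past t n 0] ((D.pathW ⁻¹' A).indicator (1 : Ω → ℝ≥0∞)) :=
    (@measurable_const _ _ _ (D.past t n 0) (1 : ℝ≥0∞)).indicator hB
  have h := lintegral_mul_prod_of_indep (D.past t n) (D.past_mono t n) (D.past_le t n)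
    (D.moves t n) (fun k => D.measurable_moves_past t n k.lt_succ_self)
    (fun k => (IndepFun_iff_Indep _ _ _).1 (D.indepFun_pastMap_moves t n k))
    (fun k => D.ratio t m S n k) (fun k v => D.measurable_ratio_past t m S n k v)
    (fun _ hk ω => D.lintegral_ratio t m S hk ω) hH
  rw [lintegral_indicator_one hB'] at h
  rw [← h, ← lintegral_indicator hB']
  refine lintegral_congr fun ω => ?_
  by_cases hω : ω ∈ D.pathW ⁻¹' A
  · rw [indicator_of_mem hω, indicator_of_mem hω, Pi.one_apply, one_mul, discreteDensity]
  · rw [indicator_of_notMem hω, indicator_of_notMem hω, zero_mul]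

lemma measurable_discreteDensity (t : M.Time) (m : ℤ) (S : ℝ) (n : ℕ) :
    Measurable (D.discreteDensity t m S n) := by
  refine Finset.measurable_fun_prod _ fun k _ => ?_
  have h : Measurable fun p : Ω × (ℤ × ℤ) => D.ratio t m S n k p.1 p.2 :=
    measurable_from_prod_countable_left fun v =>
      (D.measurable_ratio_past t m S n k v).mono (D.past_le t n k) le_rfl
  exact measurable_comp_prodMk measurable_id' (D.measurable_moves t n k) h

lemma discreteDensity_eq (t : M.Time) (m : ℤ) (S : ℝ) (n : ℕ) (ω : Ω) :
    D.discreteDensity t m S n ω = ENNReal.ofReal (Real.exp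
      (∑ k ∈ Finset.range (n + 1), D.logRatio t m S n k ω (D.moves t n k ω))) := by
  rw [Real.exp_sum, ENNReal.ofReal_prod_of_nonneg fun _ _ => Real.exp_nonneg _]
  rfl

/-! ### Convergence of the discretized density -/

lemma continuous_price (t : M.Time) (S : ℝ) (ω : Ω) : Continuous fun u => D.price t S u ω := by
  have := D.brownian.continuous ω
  unfold price
  fun_prop

lemma abs_price_le {t : M.Time} {S : ℝ} {ω : Ω} {R : ℝ} (hR : ∀ u, |D.W u ω| ≤ R) (u : M.Time) :
    |D.price t S u ω| ≤ |S| + |M.σ| * (2 * R) := by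
  rw [price]
  refine (abs_add_le _ _).trans (add_le_add_right ?_ _)
  rw [abs_mul]
  gcongr
  refine (abs_sub _ _).trans ?_
  linarith [hR u, hR t]

lemma exists_abs_W_le (ω : Ω) : ∃ R, ∀ u, |D.W u ω| ≤ R := by
  obtain ⟨R, hR⟩ := isCompact_univ.exists_bound_of_continuousOn
    (D.brownian.continuous ω).continuousOn
  exact ⟨R, fun u => hR u (mem_univ u)⟩

section Good

variable {t : M.Time} {ω : Ω} (hub : HasUnitJumps t fun s => D.Nb s ω)
  (hua : HasUnitJumps t fun s => D.Na s ω) {m : ℤ} (hm : M.level m ∈ Icc M.Ylo M.Yhi)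

include hub hua hm

lemma eventually_reserveLeft_eq_index {u : M.Time} (hu : t < u) :
    ∀ᶠ n in atTop, D.reserveLeft t (M.level m) u ω =
      M.level (D.index t m n (M.idx t n u) ω) :=
  eventually_reserveLeft_eq (D.poissonB.cadlag ω) (D.poissonA.cadlag ω) hub hua hm hu

/-- The reserve argument is eventually constant in `n`, so continuity of `g` in the price alone
suffices. -/
lemma tendsto_comp_index_price {u : M.Time} (hu : t < u) (S : ℝ) {g : ℝ → ℝ → ℝ}
    (hg : ∀ y, Continuous (g y)) :
    Tendsto (fun n => g (M.level (D.index t m n (M.idx t n u) ω))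
      (D.price t S (M.grid t n (M.idx t n u)) ω)) atTop
      (𝓝 (g (D.reserveLeft t (M.level m) u ω) (D.price t S u ω))) := by
  have h1 : Tendsto (fun n => D.price t S (M.grid t n (M.idx t n u)) ω) atTop
      (𝓝 (D.price t S u ω)) := ((D.continuous_price t S ω).tendsto u).comp (tendsto_grid_idx hu)
  refine (((hg _).tendsto _).comp h1).congr' ?_
  filter_upwards [D.eventually_reserveLeft_eq_index hub hua hm hu] with n hn
  rw [hn]
  rfl

/-- Convergence of one half of the exponent of the discretized density. -/
lemma tendsto_sum_log {n' : M.Time → ℕ} (hn' : M.IsCadlagPath n')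
    (hsub : ∀ s, M.jump n' s ≠ 0 →
      M.jump (fun s => D.Nb s ω) s ≠ 0 ∨ M.jump (fun s => D.Na s ω) s ≠ 0)
    (S : ℝ) {g : ℝ → ℝ → ℝ} (hg : ∀ y, Continuous (g y)) (h0 : ∀ y s, M.a0 ≤ g y s)
    (hle : ∀ y s r, y ∈ Icc M.Ylo M.Yhi → |s| ≤ r → g y s ≤ M.lamBound r) :
    Tendsto (fun n => ∑ k ∈ Finset.range (n + 1),
      (Real.log (g (M.level (D.index t m n k ω)) (D.price t S (M.grid t n k) ω) / M.a0) *
          ((n' (M.grid t n (k + 1)) : ℝ) - n' (M.grid t n k)) -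
        (g (M.level (D.index t m n k ω)) (D.price t S (M.grid t n k) ω) - M.a0) * M.mesh t n))
      atTop (𝓝 ((∑ u ∈ D.times t ω,
          Real.log (g (D.reserveLeft t (M.level m) u ω) (D.price t S u ω) / M.a0) * M.jump n' u)
        - ∫ u in Ioi t, (g (D.reserveLeft t (M.level m) u ω) (D.price t S u ω) - M.a0)
          ∂M.lebesgue)) := by
  have hb := D.poissonB.cadlag ω
  have ha := D.poissonA.cadlag ω
  have h1 : Tendsto (fun n => (∑ u ∈ D.times t ω,
      Real.log (g (M.level (D.index t m n (M.idx t n u) ω))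
        (D.price t S (M.grid t n (M.idx t n u)) ω) / M.a0) * M.jump n' u)) atTop
      (𝓝 (∑ u ∈ D.times t ω,
        Real.log (g (D.reserveLeft t (M.level m) u ω) (D.price t S u ω) / M.a0) * M.jump n' u)) := by
    refine tendsto_finsetSum _ fun u hu => ?_
    have hu' := ((mem_jumpTimes_Ioi hb ha).1 hu).1
    refine Tendsto.mul_const _ (Tendsto.log ?_ ?_)
    · exact (D.tendsto_comp_index_price hub hua hm hu' S hg).div_const _
    · exact (div_pos (M.a0_pos.trans_le (h0 _ _)) M.a0_pos).ne'
  obtain ⟨R, hR⟩ := D.exists_abs_W_le ω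
  have h2 : Tendsto (fun n => ∫ u in Ioi t, (g (M.level (D.index t m n (M.idx t n u) ω))
        (D.price t S (M.grid t n (M.idx t n u)) ω) - M.a0) ∂M.lebesgue) atTop
      (𝓝 (∫ u in Ioi t, (g (D.reserveLeft t (M.level m) u ω) (D.price t S u ω) - M.a0)
          ∂M.lebesgue)) := by
    refine tendsto_integral_of_dominated_convergence
      (fun _ => M.lamBound (|S| + |M.σ| * (2 * R))) ?_ (integrable_const _) ?_ ?_
    · intro n
      exact ((Measurable.of_discrete (f := fun k => g (M.level (D.index t m n k ω))
        (D.price t S (M.grid t n k) ω) - M.a0)).comp (measurable_idx t n)).aestronglyMeasurable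
    · intro n
      refine Eventually.of_forall fun u => ?_
      rw [Real.norm_of_nonneg (sub_nonneg.2 (h0 _ _))]
      have := hle _ _ _ (chain_mem hm (fun j => D.moves t n j ω) (M.idx t n u))
        (D.abs_price_le (t := t) (S := S) hR (M.grid t n (M.idx t n u)))
      exact (sub_le_self _ M.a0_pos.le).trans this
    · filter_upwards [ae_restrict_mem measurableSet_Ioi] with u hu
      exact (D.tendsto_comp_index_price hub hua hm hu S hg).sub_const _
  refine (h1.sub h2).congr' ?_
  filter_upwards [eventually_injOn_idx_jumpTimes hb ha (t := t)] with n hn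
  rw [Finset.sum_sub_distrib, sum_mul_sub_grid hb ha hn' hsub hn (fun k =>
    Real.log (g (M.level (D.index t m n k ω)) (D.price t S (M.grid t n k) ω) / M.a0)),
    ← setIntegral_idx t n (fun k =>
      g (M.level (D.index t m n k ω)) (D.price t S (M.grid t n k) ω) - M.a0)]
  rfl

lemma tendsto_discreteDensity (S : ℝ) :
    Tendsto (fun n => D.discreteDensity t m S n ω) atTop
      (𝓝 (ENNReal.ofReal (D.density t (M.level m) S ω))) := by
  have hB := D.tendsto_sum_log hub hua hm (D.poissonB.cadlag ω) (fun s h => Or.inl h) S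
    continuous_lamB a0_le_lamB (fun y s r => lamB_le)
  have hA := D.tendsto_sum_log hub hua hm (D.poissonA.cadlag ω) (fun s h => Or.inr h) S
    continuous_lamA a0_le_lamA (fun y s r => lamA_le)
  refine (ENNReal.tendsto_ofReal ((Real.continuous_exp.tendsto _).comp (hB.add hA))).congr ?_
  intro n
  rw [discreteDensity_eq, Function.comp_apply, ← Finset.sum_add_distrib]
  congr 2
  refine Finset.sum_congr rfl fun k _ => ?_
  simp [logRatio, stepB, stepA, moves, incr]

end Good

end Driver

end AMM.Model
end

noncomputable section

namespace AMM.Model.Driver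

open scoped NNReal ENNReal

variable {M : Model} {Ω : Type*} [mΩ : MeasurableSpace Ω] {P : Measure Ω} [IsProbabilityMeasure P]
  (D : M.Driver P) {m : ℤ} (hm : M.level m ∈ Icc M.Ylo M.Yhi)

omit D [IsProbabilityMeasure P] in
-- Dominated convergence on `B`. The limit `f` need not be measurable, so no measurability of
-- `density` has to be proved.
lemma withDensity_apply_of_tendsto {B : Set Ω} (hB : MeasurableSet B) {F : ℕ → Ω → ℝ≥0∞}
    {f bound : Ω → ℝ≥0∞} (hF : ∀ n, Measurable (F n))
    (hint : ∀ n, ∫⁻ ω in B, F n ω ∂P = P B) (hbound : ∀ n, ∀ᵐ ω ∂P, ω ∈ B → F n ω ≤ bound ω)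
    (hfin : ∫⁻ ω, bound ω ∂P ≠ ∞) (hlim : ∀ᵐ ω ∂P, Tendsto (fun n => F n ω) atTop (𝓝 (f ω))) :
    P.withDensity f B = P B := by
  have h := tendsto_lintegral_of_dominated_convergence (μ := P.restrict B) bound hF
    (fun n => (ae_restrict_iff' hB).2 (hbound n))
    (ne_top_of_le_ne_top hfin (setLIntegral_le_lintegral B bound)) (ae_restrict_of_ae hlim)
  simp only [hint] at h
  rw [withDensity_apply _ hB]
  exact tendsto_nhds_unique h tendsto_const_nhds

/-! ### The change of measure does not affect the Brownian motion -/

variable (M) in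
/-- The horizon, as a point of `[0, T]`. -/
def horizon : M.Time := ⟨M.T, M.T_pos.le, le_rfl⟩

omit [IsProbabilityMeasure P] in
lemma sum_moves (t : M.Time) (n : ℕ) (ω : Ω) :
    (∑ k ∈ Finset.range (n + 1), ((D.moves t n k ω).1 : ℝ) =
        (((D.Nb (horizon M) ω : ℤ) - D.Nb t ω : ℤ) : ℝ)) ∧
      ∑ k ∈ Finset.range (n + 1), ((D.moves t n k ω).2 : ℝ) =
        (((D.Na (horizon M) ω : ℤ) - D.Na t ω : ℤ) : ℝ) := by
  have hend : M.grid t n (n + 1) = horizon M := by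
    refine Subtype.ext ?_
    rw [coe_grid t le_rfl, mesh, horizon]
    push_cast
    field_simp
    ring
  constructor
  · have h := Finset.sum_range_sub (fun k => (D.Nb (M.grid t n k) ω : ℤ)) (n + 1)
    rw [hend, grid_zero] at h
    rw [← Int.cast_sum]
    exact congrArg _ h
  · have h := Finset.sum_range_sub (fun k => (D.Na (M.grid t n k) ω : ℤ)) (n + 1)
    rw [hend, grid_zero] at h
    rw [← Int.cast_sum]
    exact congrArg _ h

omit [IsProbabilityMeasure P] in
include hm in
-- Compensators are non-negative because intensities are at least `a0`, and may be dropped; with the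
-- logarithms bounded by a constant, the increments telescope to a majorant free of `n`.
lemma discreteDensity_le {t : M.Time} {S : ℝ} {n : ℕ} {ω : Ω} {R : ℝ} (hR : ∀ u, |D.W u ω| ≤ R)
    (hpos : ∀ k, 0 ≤ (D.moves t n k ω).1 ∧ 0 ≤ (D.moves t n k ω).2) :
    D.discreteDensity t m S n ω ≤
      ENNReal.ofReal (Real.exp (Real.log (M.lamBound (|S| + |M.σ| * (2 * R)) / M.a0) *
          (((D.Nb (horizon M) ω : ℤ) - D.Nb t ω : ℤ) : ℝ))) *
        ENNReal.ofReal (Real.exp (Real.log (M.lamBound (|S| + |M.σ| * (2 * R)) / M.a0) *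
          (((D.Na (horizon M) ω : ℤ) - D.Na t ω : ℤ) : ℝ))) := by
  rw [discreteDensity_eq, ← ENNReal.ofReal_mul (Real.exp_nonneg _), ← Real.exp_add,
    ← (D.sum_moves t n ω).1, ← (D.sum_moves t n ω).2, Finset.mul_sum, Finset.mul_sum,
    ← Finset.sum_add_distrib]
  refine ENNReal.ofReal_le_ofReal (Real.exp_le_exp.2 (Finset.sum_le_sum fun k _ => ?_))
  have key : ∀ l b : ℝ, M.a0 ≤ l → l ≤ M.lamBound (|S| + |M.σ| * (2 * R)) → 0 ≤ b →
      Real.log (l / M.a0) * b - (l - M.a0) * M.mesh t n ≤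
        Real.log (M.lamBound (|S| + |M.σ| * (2 * R)) / M.a0) * b := by
    intro l b h1 h2 hb
    have h0 := M.a0_pos
    have hl : 0 < l := h0.trans_le h1
    have h3 : Real.log (l / M.a0) ≤ Real.log (M.lamBound (|S| + |M.σ| * (2 * R)) / M.a0) :=
      Real.log_le_log (by positivity) (by gcongr)
    have h4 := mul_nonneg (sub_nonneg.2 h1) (mesh_nonneg t n)
    have h5 := mul_le_mul_of_nonneg_right h3 hb
    linarith
  have hlev := chain_mem hm (fun j => D.moves t n j ω) k
  have hp := D.abs_price_le (t := t) (S := S) hR (M.grid t n k)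
  exact add_le_add
    (key _ _ (a0_le_lamB _ _) (lamB_le hlev hp) (by exact_mod_cast (hpos k).1))
    (key _ _ (a0_le_lamA _ _) (lamA_le hlev hp) (by exact_mod_cast (hpos k).2))

omit [IsProbabilityMeasure P] in
lemma lintegral_exp_mul_exp_ne_top (t : M.Time) (x : ℝ) :
    ∫⁻ ω, ENNReal.ofReal (Real.exp (x * (((D.Nb (horizon M) ω : ℤ) - D.Nb t ω : ℤ) : ℝ))) *
        ENNReal.ofReal (Real.exp (x * (((D.Na (horizon M) ω : ℤ) - D.Na t ω : ℤ) : ℝ))) ∂P ≠ ∞ := by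
  have hg : Measurable fun b : ℤ => ENNReal.ofReal (Real.exp (x * b)) := Measurable.of_discrete
  have hind : IndepFun (fun ω => (D.Nb (horizon M) ω : ℤ) - D.Nb t ω)
      (fun ω => (D.Na (horizon M) ω : ℤ) - D.Na t ω) P :=
    D.indep_N.comp (measurable_path_sub (horizon M) t) (measurable_path_sub (horizon M) t)
  have hB := D.poissonB.measurable_sub t (horizon M)
  have hA := D.poissonA.measurable_sub t (horizon M)
  have ht : t ≤ horizon M := t.2.2
  have h := lintegral_mul_eq_lintegral_mul_lintegral_of_indepFun'' (hg.comp hB).aemeasurable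
    (hg.comp hA).aemeasurable (hind.comp hg hg)
  simp only [Function.comp_apply] at h
  rw [h, ← lintegral_map (f := fun b : ℤ => ENNReal.ofReal (Real.exp (x * b))) hg hB,
    ← lintegral_map (f := fun b : ℤ => ENNReal.ofReal (Real.exp (x * b))) hg hA,
    (D.poissonB.law t _ ht).map_eq, (D.poissonA.law t _ ht).map_eq, lintegral_exp_poissonMeasure]
  exact ENNReal.mul_ne_top ENNReal.ofReal_ne_top ENNReal.ofReal_ne_top

omit [IsProbabilityMeasure P] in
lemma ae_hasUnitJumps (t : M.Time) :
    ∀ᵐ ω ∂P, (HasUnitJumps t fun s => D.Nb s ω) ∧ HasUnitJumps t fun s => D.Na s ω :=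
  (D.poissonB.ae_hasUnitJumps t).and (D.poissonA.ae_hasUnitJumps t)

omit [IsProbabilityMeasure P] in
lemma ae_moves_nonneg (t : M.Time) :
    ∀ᵐ ω ∂P, ∀ n k, 0 ≤ (D.moves t n k ω).1 ∧ 0 ≤ (D.moves t n k ω).2 :=
  ae_all_iff.2 fun n => ae_all_iff.2 fun k =>
    (D.poissonB.ae_sub_nonneg (grid_mono t n k.le_succ)).and
      (D.poissonA.ae_sub_nonneg (grid_mono t n k.le_succ))

include hm

/-- Localisation to bounded Brownian paths makes the intensities bounded by a constant, hence the
majorant integrable. -/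
lemma stateMeasure_preimage_of_bounded (t : M.Time) (S : ℝ) {A : Set (M.Time → ℝ)}
    (hA : MeasurableSet A) {R : ℝ} (hR : ∀ ω, D.pathW ω ∈ A → ∀ u, |D.W u ω| ≤ R) :
    D.stateMeasure t (M.level m) S (D.pathW ⁻¹' A) = P (D.pathW ⁻¹' A) := by
  refine withDensity_apply_of_tendsto (D.measurable_pathW hA)
    (fun n => D.measurable_discreteDensity t m S n)
    (fun n => D.setLIntegral_discreteDensity t m S n hA) ?_ (D.lintegral_exp_mul_exp_ne_top t
      (Real.log (M.lamBound (|S| + |M.σ| * (2 * R)) / M.a0))) ?_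
  · intro n
    filter_upwards [D.ae_moves_nonneg t] with ω hω hωA
    exact D.discreteDensity_le hm (hR ω hωA) (hω n)
  · filter_upwards [D.ae_hasUnitJumps t] with ω hω
    exact D.tendsto_discreteDensity hω.1 hω.2 hm S

/-- The path of `W` has the same law under the measures `stateMeasure` and `P`. -/
lemma map_pathW_stateMeasure (t : M.Time) (S : ℝ) :
    (D.stateMeasure t (M.level m) S).map D.pathW = P.map D.pathW := by
  obtain ⟨s, hsc, hsd⟩ := TopologicalSpace.exists_countable_dense M.Time
  -- The product σ-algebra only sees countably many coordinates, so the bound is imposed on a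
  -- countable dense set; continuity of `W` extends it to all times.
  let B : ℕ → Set (M.Time → ℝ) := fun R => ⋂ u ∈ s, {w | |w u| ≤ R}
  have hB : ∀ R, MeasurableSet (B R) := fun R => MeasurableSet.biInter hsc fun u _ =>
    measurableSet_le (by fun_prop) measurable_const
  have hBR : ∀ R ω, D.pathW ω ∈ B R → ∀ u, |D.W u ω| ≤ R := by
    intro R ω h u
    have hcl : IsClosed {u | |D.W u ω| ≤ R} :=
      isClosed_le (D.brownian.continuous ω).abs continuous_const
    have hsub : s ⊆ {u | |D.W u ω| ≤ R} := fun v hv => mem_iInter₂.1 h v hv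
    exact hcl.closure_subset_iff.2 hsub (hsd u)
  ext A hA
  rw [Measure.map_apply D.measurable_pathW hA, Measure.map_apply D.measurable_pathW hA]
  have hU : D.pathW ⁻¹' A = ⋃ R, D.pathW ⁻¹' (A ∩ B R) := by
    ext ω
    simp only [mem_iUnion, mem_preimage, mem_inter_iff]
    refine ⟨fun h => ?_, fun ⟨_, h, _⟩ => h⟩
    obtain ⟨R, hR⟩ := D.exists_abs_W_le ω
    obtain ⟨k, hk⟩ := exists_nat_ge R
    exact ⟨k, h, mem_iInter₂.2 fun u _ => (hR u).trans hk⟩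
  have hmono : Monotone fun R => D.pathW ⁻¹' (A ∩ B R) := by
    intro R R' h ω hω
    refine ⟨hω.1, mem_iInter₂.2 fun u hu => ?_⟩
    have h1 : |D.pathW ω u| ≤ R := mem_iInter₂.1 hω.2 u hu
    exact h1.trans (Nat.cast_le.2 h)
  rw [hU, hmono.measure_iUnion, hmono.measure_iUnion]
  exact iSup_congr fun R => D.stateMeasure_preimage_of_bounded hm t S (hA.inter (hB R))
    fun ω hω => hBR R ω hω.2

lemma isProbabilityMeasure_stateMeasure (t : M.Time) (S : ℝ) :
    IsProbabilityMeasure (D.stateMeasure t (M.level m) S) := by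
  constructor
  have h := congrArg (fun μ => μ univ) (D.map_pathW_stateMeasure hm t S)
  simp only [Measure.map_apply D.measurable_pathW MeasurableSet.univ, preimage_univ] at h
  rw [h, measure_univ]

/-! ### Second moment of the price -/

omit hm [IsProbabilityMeasure P] in
lemma lintegral_price_sq (t u : M.Time) (htu : t ≤ u) (S : ℝ) {C : ℝ} (hC : 0 ≤ C) :
    ∫⁻ ω, ENNReal.ofReal (C * (1 + D.price t S u ω ^ 2)) ∂P =
      ENNReal.ofReal (C * (1 + S ^ 2 + M.σ ^ 2 * ((u : ℝ) - t))) := by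
  have hv : (((u : ℝ) - t).toNNReal : ℝ) = (u : ℝ) - t :=
    Real.coe_toNNReal _ (sub_nonneg.2 htu)
  set v := ((u : ℝ) - t).toNNReal with hvdef
  have hmap := (D.brownian.law t u htu).map_eq
  have hmeas : Measurable fun ω => D.W u ω - D.W t ω :=
    (D.brownian.measurable u).sub (D.brownian.measurable t)
  have h1 : ∫⁻ ω, ENNReal.ofReal (C * (1 + D.price t S u ω ^ 2)) ∂P =
      ∫⁻ x, ENNReal.ofReal (C * (1 + (S + M.σ * x) ^ 2)) ∂(gaussianReal 0 v) := by
    rw [hvdef, ← hmap, lintegral_map (by fun_prop) hmeas]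
    rfl
  have hi2 : Integrable (fun x : ℝ => x ^ 2) (gaussianReal 0 v) :=
    (memLp_id_gaussianReal (μ := 0) (v := v) 2).integrable_sq
  have hi1 : Integrable (fun x : ℝ => x) (gaussianReal 0 v) :=
    (memLp_id_gaussianReal (μ := 0) (v := v) 1).integrable le_rfl
  have hvar : ∫ x, x ^ 2 ∂(gaussianReal 0 v) = v := by
    have h := variance_eq_sub (memLp_id_gaussianReal (μ := 0) (v := v) 2)
    rw [variance_id_gaussianReal] at h
    simp only [id, integral_id_gaussianReal, Pi.pow_apply] at h
    simpa using h.symm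
  have he : (fun x : ℝ => C * (1 + (S + M.σ * x) ^ 2)) = fun x =>
      C * (1 + S ^ 2) + C * (2 * S * M.σ) * x + C * M.σ ^ 2 * x ^ 2 := by
    funext x
    ring
  have hJ : Integrable (fun x : ℝ => C * (1 + S ^ 2) + C * (2 * S * M.σ) * x) (gaussianReal 0 v) :=
    (integrable_const _).add (hi1.const_mul _)
  have hI : Integrable (fun x : ℝ => C * (1 + (S + M.σ * x) ^ 2)) (gaussianReal 0 v) := by
    rw [he]
    exact hJ.add (hi2.const_mul _)
  rw [h1, ← ofReal_integral_eq_lintegral_ofReal hI (Eventually.of_forall fun x => by positivity), he,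
    integral_add hJ (hi2.const_mul _),
    integral_add (integrable_const _) (hi1.const_mul _), integral_const_mul (C * (2 * S * M.σ)),
    integral_const_mul (C * M.σ ^ 2), integral_const,
    hvar, integral_id_gaussianReal, hv]
  congr 1
  simp
  ring

/-- The price is a function of the path of `W`, whose law is the same under both measures. -/
lemma lintegral_price_sq_stateMeasure (t u : M.Time) (htu : t ≤ u) (S : ℝ) {C : ℝ} (hC : 0 ≤ C) :
    ∫⁻ ω, ENNReal.ofReal (C * (1 + D.price t S u ω ^ 2)) ∂(D.stateMeasure t (M.level m) S) =
      ENNReal.ofReal (C * (1 + S ^ 2 + M.σ ^ 2 * ((u : ℝ) - t))) := by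
  rw [← D.lintegral_price_sq t u htu S hC]
  have hg : Measurable fun w : M.Time → ℝ =>
      ENNReal.ofReal (C * (1 + (S + M.σ * (w u - w t)) ^ 2)) := by fun_prop
  have h := lintegral_map (μ := P) hg D.measurable_pathW
  rw [← D.map_pathW_stateMeasure hm t S, lintegral_map hg D.measurable_pathW] at h
  exact h

end AMM.Model.Driver
end

noncomputable section

namespace AMM.Model

open scoped NNReal ENNReal

variable {M : Model}

/-! ### Growth of the reward rate -/

/-- Margin and intensity both grow at most linearly in the price, uniformly in the reserve, so their
product grows at most quadratically. -/
lemma exists_abs_rewardRate_le (M : Model) :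
    ∃ C, 0 ≤ C ∧ ∀ y ∈ Icc M.Ylo M.Yhi, ∀ s, |M.rewardRate y s| ≤ C * (1 + s ^ 2) := by
  obtain ⟨K, hK⟩ := M.fee_growth
  have hlo := M.Ylo_pos
  have hhi : 0 < M.Yhi := hlo.trans M.Ylo_lt_Yhi
  have hc := M.c_pos
  have hx := M.ξ_pos
  have h0 := M.a0_pos
  have h1 := M.a1_nonneg
  have h2 := M.a2_nonneg
  set b := M.c / M.Ylo + |K| * (1 + M.Yhi) with hb
  set α := M.a0 + M.a1 + M.a2 * (M.c / M.Ylo ^ 2) with hα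
  have hb0 : 0 ≤ b := by positivity
  have hα0 : 0 ≤ α := by positivity
  have hφ : ∀ z, M.Ylo ≤ z → 0 ≤ M.φ z ∧ M.φ z ≤ M.c / M.Ylo := fun z hz => by
    have hz0 : 0 < z := hlo.trans_le hz
    refine ⟨by rw [φ]; positivity, ?_⟩
    rw [φ]
    gcongr
  have hfee : ∀ y ∈ Icc M.Ylo M.Yhi, 0 ≤ M.fee y ∧ M.fee y ≤ |K| * (1 + M.Yhi) := fun y hy => by
    have hy0 : 0 ≤ y := hlo.le.trans hy.1
    refine ⟨M.fee_nonneg y hy0, (hK y hy0).trans ?_⟩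
    have : K * (1 + y) ≤ |K| * (1 + y) := mul_le_mul_of_nonneg_right (le_abs_self K) (by linarith)
    refine this.trans (mul_le_mul_of_nonneg_left ?_ (abs_nonneg K))
    linarith [hy.2]
  have hxs : ∀ s : ℝ, |M.ξ * s| = M.ξ * |s| := fun s => by rw [abs_mul, abs_of_pos hx]
  have hlam : ∀ l s : ℝ, M.a0 ≤ l → l ≤ M.lamBound |s| → |l| ≤ α + M.a2 * |s| := by
    intro l s hl hl'
    rw [abs_of_nonneg (h0.le.trans hl)]
    refine hl'.trans (le_of_eq ?_)
    rw [lamBound, hα]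
    ring
  -- The factors are bounded by `b + ξ|s|` and `α + a2|s|`; the `2` counts the two sides of the
  -- market.
  refine ⟨2 * ((b + M.ξ) * (α + M.a2)), by positivity, fun y hy s => ?_⟩
  have hprod : ∀ p q : ℝ, |p| ≤ b + M.ξ * |s| → |q| ≤ α + M.a2 * |s| →
      |p * q| ≤ (b + M.ξ) * (α + M.a2) * (1 + s ^ 2) := by
    intro p q hp hq
    rw [abs_mul]
    have hs0 := abs_nonneg s
    have hs2 : |s| ^ 2 = s ^ 2 := sq_abs s
    have hs1 : |s| ≤ 1 + s ^ 2 := by nlinarith [sq_nonneg (|s| - 1)]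
    have hs3 : (0 : ℝ) ≤ s ^ 2 := sq_nonneg s
    calc |p| * |q| ≤ (b + M.ξ * |s|) * (α + M.a2 * |s|) :=
          mul_le_mul hp hq (abs_nonneg q) (by positivity)
      _ = b * α + (b * M.a2 + M.ξ * α) * |s| + M.ξ * M.a2 * |s| ^ 2 := by ring
      _ ≤ b * α * (1 + s ^ 2) + (b * M.a2 + M.ξ * α) * (1 + s ^ 2) +
          M.ξ * M.a2 * (1 + s ^ 2) := by
        rw [hs2]
        have e1 : b * α ≤ b * α * (1 + s ^ 2) := le_mul_of_one_le_right (by positivity) (by linarith)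
        have e2 := mul_le_mul_of_nonneg_left hs1 (show 0 ≤ b * M.a2 + M.ξ * α by positivity)
        have e3 := mul_le_mul_of_nonneg_left (show s ^ 2 ≤ 1 + s ^ 2 by linarith)
          (show 0 ≤ M.ξ * M.a2 by positivity)
        linarith
      _ = (b + M.ξ) * (α + M.a2) * (1 + s ^ 2) := by ring
  have hnn : 0 ≤ (b + M.ξ) * (α + M.a2) * (1 + s ^ 2) := by positivity
  have hB : |M.betaB y s * M.lamB y s| ≤ (b + M.ξ) * (α + M.a2) * (1 + s ^ 2) := by
    refine hprod _ _ ?_ (hlam _ _ (a0_le_lamB _ _) (lamB_le hy le_rfl))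
    have e1 := hφ (y + M.ξ) (by linarith [hy.1])
    have e2 := hφ y hy.1
    have e3 := hfee y hy
    have e4 := abs_le.1 (hxs s).le
    rw [betaB, abs_le]
    constructor <;> linarith
  -- Below `Ylo` the quotient `c / (y - ξ)` is not controlled by `c / Ylo`, but there the indicator
  -- vanishes.
  have hA : M.Ylo ≤ y - M.ξ →
      |M.betaA y s * M.lamA y s| ≤ (b + M.ξ) * (α + M.a2) * (1 + s ^ 2) := by
    intro hy'
    refine hprod _ _ ?_ (hlam _ _ (a0_le_lamA _ _) (lamA_le hy le_rfl))
    have e1 := hφ (y - M.ξ) hy'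
    have e2 := hφ y hy.1
    have e3 := hfee y hy
    have e4 := abs_le.1 (hxs s).le
    rw [betaA, abs_le]
    constructor <;> linarith
  rw [rewardRate]
  refine (abs_add_le _ _).trans ?_
  have f1 : |M.betaB y s * M.lamB y s * (if y + M.ξ ≤ M.Yhi then 1 else 0)| ≤
      (b + M.ξ) * (α + M.a2) * (1 + s ^ 2) := by
    split_ifs
    · rwa [mul_one]
    · rwa [mul_zero, abs_zero]
  have f2 : |M.betaA y s * M.lamA y s * (if M.Ylo ≤ y - M.ξ then 1 else 0)| ≤
      (b + M.ξ) * (α + M.a2) * (1 + s ^ 2) := by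
    split_ifs with h
    · rw [mul_one]
      exact hA h
    · rwa [mul_zero, abs_zero]
  linarith

lemma continuous_rewardRate (y : ℝ) : Continuous (M.rewardRate y) := by
  have hb := continuous_lamB (M := M) y
  have ha := continuous_lamA (M := M) y
  have hb' : Continuous (M.betaB y) := by unfold betaB; fun_prop
  have ha' : Continuous (M.betaA y) := by unfold betaA; fun_prop
  unfold rewardRate
  fun_prop

/-! ### Measurability and integrability of the stopped reward -/

namespace Driver

variable {Ω : Type*} [mΩ : MeasurableSpace Ω] {P : Measure Ω}
  (D : M.Driver P) {m : ℤ} (hm : M.level m ∈ Icc M.Ylo M.Yhi)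

lemma measurable_index (t : M.Time) (m : ℤ) (n k : ℕ) : Measurable (D.index t m n k) :=
  (D.measurable_index_past t m n k).mono (D.past_le t n k) le_rfl

lemma measurable_uncurry_price (t : M.Time) (S : ℝ) :
    Measurable fun p : Ω × M.Time => D.price t S p.2 p.1 := by
  have h : Measurable (Function.uncurry fun (u : M.Time) ω => D.price t S u ω) :=
    measurable_uncurry_of_continuous_of_measurable (fun ω => D.continuous_price t S ω) fun u => by
      have h1 := D.brownian.measurable u
      have h2 := D.brownian.measurable t
      unfold price
      fun_prop
  exact h.comp measurable_swap

omit mΩ D in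
lemma measurable_uncurry_of_countable {g : ℤ → ℝ → ℝ} (hg : ∀ i, Measurable (g i)) :
    Measurable fun p : ℤ × ℝ => g p.1 p.2 := measurable_from_prod_countable_right hg

omit D in
lemma measurable_eval_index {α β : Type*} [MeasurableSpace α] [MeasurableSpace β] {f : ℕ → Ω → β}
    (hf : ∀ k, Measurable (f k)) {i : α → ℕ} (hi : Measurable i) :
    Measurable fun p : Ω × α => f (i p.2) p.1 := by
  have h1 : Measurable fun p : Ω × ℕ => f p.2 p.1 := measurable_from_prod_countable_left hf
  exact h1.comp (measurable_fst.prodMk (hi.comp measurable_snd))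

/-- Only the reserve is discretized, the price being jointly measurable by path continuity; these
approximations are therefore eventually equal to `rate`. -/
lemma measurable_discreteRate (t : M.Time) (m : ℤ) (S : ℝ) (n : ℕ) :
    Measurable fun p : Ω × M.Time =>
      M.rewardRate (M.level (D.index t m n (M.idx t n p.2) p.1)) (D.price t S p.2 p.1) := by
  have h3 : Measurable fun p : Ω × M.Time => D.index t m n (M.idx t n p.2) p.1 :=
    measurable_eval_index (D.measurable_index t m n) (measurable_idx t n)
  have h4 : Measurable fun p : ℤ × ℝ => M.rewardRate (M.level p.1) p.2 :=
    measurable_uncurry_of_countable (g := fun i => M.rewardRate (M.level i)) fun i =>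
      (continuous_rewardRate (M.level i)).measurable
  exact measurable_comp_prodMk (f := fun p : Ω × M.Time => D.index t m n (M.idx t n p.2) p.1)
    (g := fun p => D.price t S p.2 p.1) h3 (D.measurable_uncurry_price t S) h4

lemma stateMeasure_absolutelyContinuous (t : M.Time) (y S : ℝ) : D.stateMeasure t y S ≪ P :=
  withDensity_absolutelyContinuous _ _

omit mΩ D in
lemma ae_prod_restrict_Ioi {mΩ : MeasurableSpace Ω} {Q : Measure Ω} {t : M.Time} {p : Ω → Prop}
    (h : ∀ᵐ ω ∂Q, p ω) :
    ∀ᵐ z ∂(Q.prod (M.lebesgue.restrict (Ioi t))), p z.1 ∧ t < z.2 := by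
  have h1 : ∀ᵐ z ∂(Q.prod (M.lebesgue.restrict (Ioi t))), p z.1 :=
    Measure.quasiMeasurePreserving_fst.ae h
  have h2 : ∀ᵐ z ∂(Q.prod (M.lebesgue.restrict (Ioi t))), t < z.2 :=
    Measure.quasiMeasurePreserving_snd.ae (ae_restrict_mem measurableSet_Ioi)
  exact h1.and h2

include hm

lemma ae_eventually_discreteRate_eq (t : M.Time) (S : ℝ) :
    ∀ᵐ z ∂((D.stateMeasure t (M.level m) S).prod (M.lebesgue.restrict (Ioi t))),
      ∀ᶠ n in atTop, D.rate t (M.level m) S z.2 z.1 =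
        M.rewardRate (M.level (D.index t m n (M.idx t n z.2) z.1)) (D.price t S z.2 z.1) := by
  filter_upwards [ae_prod_restrict_Ioi (t := t)
    ((D.stateMeasure_absolutelyContinuous t (M.level m) S).ae_le (D.ae_hasUnitJumps t))] with z hz
  filter_upwards [D.eventually_reserveLeft_eq_index hz.1.1 hz.1.2 hm hz.2] with n hn
  rw [rate, hn]

lemma aestronglyMeasurable_rate (t : M.Time) (S : ℝ) :
    AEStronglyMeasurable (fun z : Ω × M.Time => D.rate t (M.level m) S z.2 z.1)
      ((D.stateMeasure t (M.level m) S).prod (M.lebesgue.restrict (Ioi t))) := by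
  refine aestronglyMeasurable_of_tendsto_ae atTop
    (fun n => (D.measurable_discreteRate t m S n).aestronglyMeasurable) ?_
  filter_upwards [D.ae_eventually_discreteRate_eq hm t S] with z hz
  exact tendsto_const_nhds.congr' hz

/-- That the reserve stays in `[Ylo, Yhi]` is read off the chain, with which it eventually agrees.
-/
lemma ae_abs_rate_le (t : M.Time) (S : ℝ) {C : ℝ}
    (hC : ∀ y ∈ Icc M.Ylo M.Yhi, ∀ s, |M.rewardRate y s| ≤ C * (1 + s ^ 2)) :
    ∀ᵐ z ∂((D.stateMeasure t (M.level m) S).prod (M.lebesgue.restrict (Ioi t))),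
      |D.rate t (M.level m) S z.2 z.1| ≤ C * (1 + D.price t S z.2 z.1 ^ 2) := by
  filter_upwards [D.ae_eventually_discreteRate_eq hm t S] with z hz
  obtain ⟨n, hn⟩ := hz.exists
  rw [hn]
  exact hC _ (chain_mem hm _ _) _

variable [IsProbabilityMeasure P]

lemma lintegral_rate_le (t : M.Time) (S : ℝ) {C : ℝ} (hC0 : 0 ≤ C)
    (hC : ∀ y ∈ Icc M.Ylo M.Yhi, ∀ s, |M.rewardRate y s| ≤ C * (1 + s ^ 2)) :
    ∫⁻ z, ‖D.rate t (M.level m) S z.2 z.1‖ₑ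
        ∂((D.stateMeasure t (M.level m) S).prod (M.lebesgue.restrict (Ioi t))) ≤
      ENNReal.ofReal (C * (1 + M.σ ^ 2 * M.T) * M.T * (1 + S ^ 2)) := by
  have hQ := D.isProbabilityMeasure_stateMeasure hm t S
  have hT := M.T_pos
  have hmeas : Measurable fun z : Ω × M.Time =>
      ENNReal.ofReal (C * (1 + D.price t S z.2 z.1 ^ 2)) := by
    have := D.measurable_uncurry_price t S
    fun_prop
  calc _ ≤ ∫⁻ z, ENNReal.ofReal (C * (1 + D.price t S z.2 z.1 ^ 2))
        ∂((D.stateMeasure t (M.level m) S).prod (M.lebesgue.restrict (Ioi t))) := by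
        refine lintegral_mono_ae ?_
        filter_upwards [D.ae_abs_rate_le hm t S hC] with z hz
        rw [Real.enorm_eq_ofReal_abs]
        exact ENNReal.ofReal_le_ofReal hz
    _ = ∫⁻ u in Ioi t, ∫⁻ ω, ENNReal.ofReal (C * (1 + D.price t S u ω ^ 2))
        ∂(D.stateMeasure t (M.level m) S) ∂M.lebesgue := lintegral_prod_symm _ hmeas.aemeasurable
    _ ≤ ∫⁻ u in Ioi t, ENNReal.ofReal (C * (1 + M.σ ^ 2 * M.T) * (1 + S ^ 2)) ∂M.lebesgue := by
        refine setLIntegral_mono measurable_const fun u hu => ?_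
        rw [D.lintegral_price_sq_stateMeasure hm t u (le_of_lt hu) S hC0]
        refine ENNReal.ofReal_le_ofReal ?_
        have h1 : (u : ℝ) - t ≤ M.T := by linarith [u.2.2, t.2.1]
        have h2 := mul_le_mul_of_nonneg_left h1 (sq_nonneg M.σ)
        have h3 : 1 + S ^ 2 + M.σ ^ 2 * ((u : ℝ) - t) ≤ (1 + M.σ ^ 2 * M.T) * (1 + S ^ 2) := by
          have : 0 ≤ M.σ ^ 2 * M.T * S ^ 2 := by positivity
          linarith
        rw [mul_assoc]
        exact mul_le_mul_of_nonneg_left h3 hC0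
    _ ≤ ENNReal.ofReal (C * (1 + M.σ ^ 2 * M.T) * (1 + S ^ 2)) * ENNReal.ofReal M.T := by
        rw [setLIntegral_const, ← lebesgue_univ]
        gcongr
        exact subset_univ _
    _ = _ := by
        rw [← ENNReal.ofReal_mul (by positivity)]
        congr 1
        ring

lemma integrable_rate (t : M.Time) (S : ℝ) :
    Integrable (fun z : Ω × M.Time => D.rate t (M.level m) S z.2 z.1)
      ((D.stateMeasure t (M.level m) S).prod (M.lebesgue.restrict (Ioi t))) := by
  obtain ⟨C, hC0, hC⟩ := exists_abs_rewardRate_le M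
  exact ⟨D.aestronglyMeasurable_rate hm t S,
    (D.lintegral_rate_le hm t S hC0 hC).trans_lt ENNReal.ofReal_lt_top⟩

omit hm [IsProbabilityMeasure P] in
-- The filtration is augmented by null sets, so a stopping time is only null-measurable for the
-- ambient σ-algebra.
lemma aemeasurable_stoppingTime {t : M.Time} (τ : D.StoppingTimes t) : AEMeasurable τ.1 P := by
  have h1 : @Measurable (NullMeasurableSpace Ω P) M.Time _ _ τ.1 := by
    refine measurable_of_Iic fun i => ?_
    have h := D.filtration.le i _ (τ.2.1 i)
    simp only [WithTop.coe_le_coe] at h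
    exact h
  have h2 : NullMeasurable τ.1 P := fun s hs => h1 hs
  exact h2.aemeasurable

/-- Replacing `τ` by a measurable version makes the region before `τ` measurable in the product
space, so Fubini applies to the reward. -/
lemma integrable_stopped_rate (t : M.Time) (S : ℝ) (τ : D.StoppingTimes t) :
    ∃ A : Set (Ω × M.Time), MeasurableSet A ∧
      Integrable (A.indicator fun z : Ω × M.Time => D.rate t (M.level m) S z.2 z.1)
        ((D.stateMeasure t (M.level m) S).prod (M.lebesgue.restrict (Ioi t))) ∧
      D.reward t (M.level m) S τ.1 =ᵐ[D.stateMeasure t (M.level m) S] fun ω =>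
        ∫ u in Ioi t, A.indicator (fun z : Ω × M.Time => D.rate t (M.level m) S z.2 z.1) (ω, u)
          ∂M.lebesgue := by
  have hτ := (D.aemeasurable_stoppingTime τ).mono_ac
    (D.stateMeasure_absolutelyContinuous t (M.level m) S)
  have hA : MeasurableSet {z : Ω × M.Time | z.2 ≤ hτ.mk τ.1 z.1} :=
    measurableSet_le measurable_snd (hτ.measurable_mk.comp measurable_fst)
  refine ⟨_, hA, (D.integrable_rate hm t S).indicator hA, ?_⟩
  filter_upwards [hτ.ae_eq_mk] with ω hω
  rw [reward, ← Ioi_inter_Iic, ← setIntegral_indicator measurableSet_Iic]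
  refine integral_congr_ae (Eventually.of_forall fun u => ?_)
  simp only [indicator, mem_Iic, mem_ofPred_eq, hω]

lemma integrable_reward (t : M.Time) (S : ℝ) (τ : D.StoppingTimes t) :
    Integrable (D.reward t (M.level m) S τ.1) (D.stateMeasure t (M.level m) S) := by
  have hQ := D.isProbabilityMeasure_stateMeasure hm t S
  obtain ⟨A, -, hint, heq⟩ := D.integrable_stopped_rate hm t S τ
  exact hint.integral_prod_left.congr heq.symm

lemma ae_integrableOn_rate (t : M.Time) (S : ℝ) (τ : D.StoppingTimes t) :
    ∀ᵐ ω ∂(D.stateMeasure t (M.level m) S),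
      IntegrableOn (fun u => D.rate t (M.level m) S u ω) (Ioc t (τ.1 ω)) M.lebesgue := by
  have hQ := D.isProbabilityMeasure_stateMeasure hm t S
  filter_upwards [(D.integrable_rate hm t S).prod_right_ae] with ω hω
  exact IntegrableOn.mono_set hω Ioc_subset_Ioi_self

lemma expectedReward_le (t : M.Time) (S : ℝ) (τ : D.StoppingTimes t) {C : ℝ} (hC0 : 0 ≤ C)
    (hC : ∀ y ∈ Icc M.Ylo M.Yhi, ∀ s, |M.rewardRate y s| ≤ C * (1 + s ^ 2)) :
    D.expectedReward t (M.level m) S τ ≤ C * (1 + M.σ ^ 2 * M.T) * M.T * (1 + S ^ 2) := by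
  have hQ := D.isProbabilityMeasure_stateMeasure hm t S
  have hT := M.T_pos
  obtain ⟨A, -, hint, heq⟩ := D.integrable_stopped_rate hm t S τ
  rw [expectedReward, integral_congr_ae heq, ← integral_prod _ hint]
  refine (Real.le_norm_self _).trans ((norm_integral_le_lintegral_norm _).trans ?_)
  refine ENNReal.toReal_le_of_le_ofReal (by positivity) ?_
  refine le_trans (lintegral_mono fun z => ?_) (D.lintegral_rate_le hm t S hC0 hC)
  rw [ofReal_norm]
  exact enorm_indicator_le_enorm_self _ _

omit hm [IsProbabilityMeasure P] in
lemma exists_expectedReward_eq_zero (t : M.Time) (y S : ℝ) :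
    ∃ τ : D.StoppingTimes t, D.expectedReward t y S τ = 0 := by
  refine ⟨⟨fun _ => t, isStoppingTime_const _ t, fun _ => le_rfl⟩, ?_⟩
  simp [expectedReward, reward]

end Driver

end AMM.Model
end
-- The value function
theorem mainTheorem3 (M : AMM.Model) {Ω : Type*} [MeasurableSpace Ω] (P : MeasureTheory.Measure Ω)
    [MeasureTheory.IsProbabilityMeasure P] (D : M.Driver P) :
    (∀ (t : M.Time) (y : M.Q) (S : ℝ),
      MeasureTheory.IsProbabilityMeasure (D.stateMeasure t y S) ∧
      (∀ τ : D.StoppingTimes t,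
        (∀ᵐ ω ∂(D.stateMeasure t y S),
          MeasureTheory.IntegrableOn (fun u => D.rate t y S u ω) (Set.Ioc t (τ.1 ω)) M.lebesgue) ∧
        MeasureTheory.Integrable (D.reward t y S τ.1) (D.stateMeasure t y S)) ∧
      (Set.range (D.expectedReward t (y : ℝ) S)).Nonempty ∧
      BddAbove (Set.range (D.expectedReward t (y : ℝ) S))) ∧
    D.value ∈ M.Xi := by
  obtain ⟨C, hC0, hC⟩ := AMM.Model.exists_abs_rewardRate_le M
  have hle : ∀ (t : M.Time) (y : M.Q) (S : ℝ) (τ : D.StoppingTimes t),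
      D.expectedReward t y S τ ≤ C * (1 + M.σ ^ 2 * M.T) * M.T * (1 + S ^ 2) := by
    intro t y S τ
    obtain ⟨m, hy, hm⟩ := AMM.Model.exists_level_eq y.2
    rw [hy]
    exact D.expectedReward_le hm t S τ hC0 hC
  have hbdd : ∀ (t : M.Time) (y : M.Q) (S : ℝ),
      BddAbove (Set.range (D.expectedReward t (y : ℝ) S)) := fun t y S =>
    ⟨_, Set.forall_mem_range.2 (hle t y S)⟩
  refine ⟨fun t y S => ?_, C * (1 + M.σ ^ 2 * M.T) * M.T, fun t y S => ?_⟩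
  · obtain ⟨m, hy, hm⟩ := AMM.Model.exists_level_eq y.2
    obtain ⟨τ₀, -⟩ := D.exists_expectedReward_eq_zero t y S
    refine ⟨?_, fun τ => ?_, ⟨_, Set.mem_range_self τ₀⟩, hbdd t y S⟩
    · rw [hy]
      exact D.isProbabilityMeasure_stateMeasure hm t S
    · rw [hy]
      exact ⟨D.ae_integrableOn_rate hm t S τ, D.integrable_reward hm t S τ⟩
  · obtain ⟨τ₀, h₀⟩ := D.exists_expectedReward_eq_zero t y S
    have : Nonempty (D.StoppingTimes t) := ⟨τ₀⟩
    exact ⟨h₀.symm.le.trans (le_ciSup (hbdd t y S) τ₀), ciSup_le (hle t y S)⟩
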